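/- **Setting.** Let $d\ge 2$, $N\ge 1$, let $D\subset\mathbb R^d$ be open and bounded, $V=H^1_0(D)$ with $\|v\|_V=\|\nabla v\|_{L^2(D)}$, $f\in L^2(D)$, and $\Gamma=\prod_{n=1}^N\Gamma_n$ with $\Gamma_n=[\mathrm{lo}_n,\mathrm{hi}_n]$, $\mathrm{lo}_n<\mathrm{hi}_n$ (for instance $[-1,1]$), $|\Gamma_n|=\mathrm{hi}_n-\mathrm{lo}_n$. Let $a(y,x)=a_0(x)+\sum_{n=1}^N a_n(x)y_n$ with $a_0,\dots,a_N\in L^\infty(D)$ and $0<a_{\min}\le a(y,x)\le a_{\max}$ for all $y\in\Gamma$ and a.e. $x\in D$, and let $u:\Gamma\to V$ satisfy $\int_D a(y,x)\,\nabla u(y)\cdot\nabla v\,dx=\int_D f v\,dx$ for all $v\in V$, $y\in\Gamma$. Let $\tau\in\mathbb R_{>0}^N$ be such that $u$ extends to a bounded holomorphic function, with values in the complexification of $V$, on the interior of $\Sigma(\Gamma,\tau)=\{z\in\mathbb C^N:\operatorname{dist}(z_n,\Gamma_n)\le\tau_n\ \forall n\}$, and put $$\sigma=\min_{1\le n\le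 N}\log\Bigl(\tfrac{2\tau_n}{|\Gamma_n|}+\sqrt{1+\tfrac{4\tau_n^2}{|\Gamma_n|^2}}\Bigr).$$ **Interpolation.** Let $m(0)=0$, $m(1)=1$, $m(i)=2^{i-1}+1$ for integers $i>1$, with $m(x)=2^{x-1}+1$ also for real $x>1$. Let $\mathcal U_n^{k}$ be Lagrange interpolation in the variable $y_n$ at the $k$ Clenshaw–Curtis nodes of $\Gamma_n$ (the affine images of $-\cos\frac{\pi(j-1)}{k-1}$, $j=1,\dots,k$; the midpoint if $k=1$), $\mathcal U_n^0=0$. For multi-indices $i\in\mathbb N^N$ (entries $\ge1$) let $\Delta^{m(i)}=\bigotimes_{n=1}^N\bigl(\mathcal U_n^{m(i_n)}-\mathcal U_n^{m(i_n-1)}\bigr)$, and for finite $I\subset\mathbb N^N$ let $S_I=\sum_{i\in I}\Delta^{m(i)}$. **Algorithm.** $I$ is downward closed if $i-e_n\in I$ for all $i\in I$ and all $n$ with $i_n>1$. The margin of $I$ is $\mathcal M_I=\{i\notin I: i-e_n\in I \text{ for some } n \text{ with } i_n>1\}$. For $i\in\mathcal M_I$ let $A_{i,I}$ be the smallest subset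 of $\mathcal M_I$ containing $i$ such that $I\cup A_{i,I}$ is downward closed, and define $$\zeta_{i,I}=\bigl\|\Delta^{m(i)}\bigl(a\nabla S_I[u]\bigr)\bigr\|_{L^\infty(\Gamma,L^2(D))},\qquad \mathcal P_{i,I}=\sum_{j\in A_{i,I}}\zeta_{j,I}\quad\text{(workless profit)}.$$ Start from $I_1=\{\mathbf 1\}$, $i_0=\mathbf 1$. For $\ell\ge1$ let $i_\ell$ be a maximizer of $\mathcal P_{\cdot,I_\ell}$ over $\mathcal M_{I_\ell}$, and set $I_{\ell+1}=I_\ell\cup A_{i_\ell,I_\ell}$. Ties are broken arbitrarily (for instance lexicographically), except that a maximizer $i$ is not chosen if there is another maximizer $j\neq i$ with $j_n\ge i_n$ for all $n$. **Theorem.** For every run of the algorithm the index sets are axis-aligned rectangles: for all $\ell>0$, $$I_{\ell}=\{j\in\mathbb N^N: 1\le j_n\le (i_{\ell-1})_n\ \ \forall n\}.$$ Moreover there is a constant $C>0$, independent of $\ell$ and of the run, such that for all $\ell>0$ $$\|u-S_{I_\ell}[u]\|_{L^\infty(\Gamma,V)}\le C\Bigl(1+\bigl(1+\tfrac{\ell-1}{N}\bigr)^N\Bigr)N\,\ell^2\,e^{-\frac{\sigma}{2}\,m\left(1+\frac{\ell}{N}\right)}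 .$$ -/

import Mathlib

open MeasureTheory
open scoped ENNReal ContDiff

noncomputable section

namespace SparseCollocation

/-! ### The spatial space `V = H¹₀(D)` -/

/-- The space `ℝᵈ` with its Euclidean norm. -/
abbrev Space (d : ℕ) : Type := EuclideanSpace ℝ (Fin d)

/-- Lebesgue measure on `D`. -/
abbrev vol {d : ℕ} (D : Set (Space d)) : Measure (Space d) := volume.restrict D

/-- `L²(D)`. -/
abbrev L2 {d : ℕ} (D : Set (Space d)) : Type := Lp ℝ 2 (vol D)

/-- `L²(D; ℝᵈ)`. -/
abbrev L2Vec {d : ℕ} (D : Set (Space d)) : Type := Lp (Space d) 2 (vol D)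

/-- `L^∞(D)`. -/
abbrev LInf {d : ℕ} (D : Set (Space d)) : Type := Lp ℝ ∞ (vol D)

/-- `φ ∈ C_c^∞(D)`. -/
def IsTestFunction {d : ℕ} (D : Set (Space d)) (φ : Space d → ℝ) : Prop :=
  ContDiff ℝ ∞ φ ∧ HasCompactSupport φ ∧ tsupport φ ⊆ D

/-- The subspace `{(φ, ∇φ) : φ ∈ C_c^∞(D)}` of `L²(D) × L²(D; ℝᵈ)`. -/
def testPairs {d : ℕ} (D : Set (Space d)) : Submodule ℝ (L2 D × L2Vec D) where
  carrier := {w | ∃ φ : Space d → ℝ, IsTestFunction D φ ∧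
    w.1 =ᵐ[vol D] φ ∧ w.2 =ᵐ[vol D] fun x => gradient φ x}
  add_mem' := by
    rintro v w ⟨φ, hφ, h1, h2⟩ ⟨ψ, hψ, k1, k2⟩
    refine ⟨φ + ψ, ⟨hφ.1.add hψ.1, hφ.2.1.add hψ.2.1, ?_⟩, ?_, ?_⟩
    · exact (tsupport_add φ ψ).trans (Set.union_subset hφ.2.2 hψ.2.2)
    · filter_upwards [Lp.coeFn_add v.1 w.1, h1, k1] with x hx a b
      rw [Prod.fst_add, hx, Pi.add_apply, a, b, Pi.add_apply]
    · filter_upwards [Lp.coeFn_add v.2 w.2, h2, k2] with x hx a b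
      have e1 : DifferentiableAt ℝ φ x := (hφ.1.differentiable (by simp)) x
      have e2 : DifferentiableAt ℝ ψ x := (hψ.1.differentiable (by simp)) x
      rw [Prod.snd_add, hx, Pi.add_apply, a, b]
      simp [gradient, fderiv_add e1 e2]
  zero_mem' := by
    refine ⟨0, ⟨contDiff_const, HasCompactSupport.zero, by simp [tsupport]⟩, ?_, ?_⟩
    · exact Lp.coeFn_zero _ _ _
    · filter_upwards [Lp.coeFn_zero (Space d) 2 (vol D)] with x hx
      rw [Prod.snd_zero, hx]
      simp [gradient]
  smul_mem' := by
    rintro c w ⟨φ, hφ, h1, h2⟩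
    refine ⟨c • φ, ⟨hφ.1.const_smul c, hφ.2.1.smul_left (f := fun _ => c), ?_⟩, ?_, ?_⟩
    · exact (tsupport_smul_subset_right (fun _ => c) φ).trans hφ.2.2
    · filter_upwards [Lp.coeFn_smul c w.1, h1] with x hx a
      rw [Prod.smul_fst, hx, Pi.smul_apply, a, Pi.smul_apply]
    · filter_upwards [Lp.coeFn_smul c w.2, h2] with x hx a
      have e1 : DifferentiableAt ℝ φ x := (hφ.1.differentiable (by simp)) x
      rw [Prod.smul_snd, hx, Pi.smul_apply, a]
      simp [gradient, fderiv_const_smul e1]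

/-- `H¹₀(D)`, the closure of `C_c^∞(D)` in the `H¹`-topology. An element is the pair of a
function and its weak gradient. -/
def H10 {d : ℕ} (D : Set (Space d)) : Submodule ℝ (L2 D × L2Vec D) :=
  (testPairs D).topologicalClosure

/-- The function itself, as an element of `L²(D)`. -/
def val {d : ℕ} {D : Set (Space d)} (v : H10 D) : L2 D := v.1.1

/-- The weak gradient, as an element of `L²(D; ℝᵈ)`. -/
def grad {d : ℕ} {D : Set (Space d)} (v : H10 D) : L2Vec D := v.1.2

/-- `‖v‖_V = ‖∇v‖_{L²(D)}`. -/
def normV {d : ℕ} {D : Set (Space d)} (v : H10 D) : ℝ := ‖grad v‖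

/-! ### The parametric diffusion problem -/

/-- The parameter box `Γ = ∏ₙ [loₙ, hiₙ]`. -/
def paramBox {N : ℕ} (lo hi : Fin N → ℝ) : Set (Fin N → ℝ) :=
  {y | ∀ n, y n ∈ Set.Icc (lo n) (hi n)}

/-- The affine coefficient `a(y, x) = a₀(x) + ∑ₙ aₙ(x) yₙ`. -/
def coeff {d N : ℕ} {D : Set (Space d)} (a₀ : LInf D) (a : Fin N → LInf D)
    (y : Fin N → ℝ) : LInf D :=
  a₀ + ∑ n, y n • a n

/-- `u` solves the weak diffusion problem for every parameter in `Γ`. -/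
def IsSolution {d N : ℕ} {D : Set (Space d)} (lo hi : Fin N → ℝ) (a₀ : LInf D)
    (a : Fin N → LInf D) (f : L2 D) (u : (Fin N → ℝ) → H10 D) : Prop :=
  ∀ y ∈ paramBox lo hi, ∀ v : H10 D,
    ∫ x in D, coeff a₀ a y x * inner ℝ (grad (u y) x) (grad v x) = ∫ x in D, f x * val v x

/-- The polystrip `Σ(Γ, τ) = {z ∈ ℂᴺ : dist(zₙ, Γₙ) ≤ τₙ for all n}`. -/
def polystrip {N : ℕ} (lo hi τ : Fin N → ℝ) : Set (Fin N → ℂ) :=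
  {z | ∀ n, Metric.infDist (z n) ((fun t : ℝ => (t : ℂ)) '' Set.Icc (lo n) (hi n)) ≤ τ n}

/-- `u : Γ → V` extends to a bounded holomorphic function `p + i q` on (the interior of)
`Σ(Γ, τ)`, with values in the complexification of `V`. Complex differentiability is real
differentiability with a complex linear derivative. -/
def HasBoundedHolomorphicExtension {d N : ℕ} {D : Set (Space d)} (lo hi τ : Fin N → ℝ)
    (u : (Fin N → ℝ) → H10 D) : Prop :=
  ∃ p q : (Fin N → ℂ) → H10 D,
    (∀ z ∈ interior (polystrip lo hi τ), ∃ P Q : (Fin N → ℂ) →L[ℝ] H10 D,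
      HasFDerivAt p P z ∧ HasFDerivAt q Q z ∧
        ∀ h, P (Complex.I • h) = -Q h ∧ Q (Complex.I • h) = P h) ∧
    (∃ M : ℝ, ∀ z ∈ interior (polystrip lo hi τ), normV (p z) ≤ M ∧ normV (q z) ≤ M) ∧
    (∀ y ∈ paramBox lo hi, p (fun n => (y n : ℂ)) = u y ∧ q (fun n => (y n : ℂ)) = 0)

/-- `σ = minₙ σₙ`, `σₙ = log (2 τₙ / |Γₙ| + √(1 + 4 τₙ² / |Γₙ|²))`. -/
def rateExponent {N : ℕ} (lo hi τ : Fin N → ℝ) : ℝ :=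
  ⨅ n, Real.log (2 * τ n / (hi n - lo n) + √(1 + 4 * τ n ^ 2 / (hi n - lo n) ^ 2))

/-! ### Sparse grid interpolation -/

/-- The doubling rule `m(0) = 0`, `m(1) = 1`, `m(i) = 2^(i-1) + 1` for `i > 1`. -/
def level : ℕ → ℕ
  | 0 => 0
  | 1 => 1
  | i + 2 => 2 ^ (i + 1) + 1

/-- The doubling rule at real arguments, given by the same formula. -/
def levelReal (x : ℝ) : ℝ :=
  if x ≤ 0 then 0 else if x ≤ 1 then 1 else 2 ^ (x - 1) + 1

/-- The `m` Clenshaw–Curtis nodes on `[lo, hi]`, the affine image of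
`-cos (π j / (m - 1)) ∈ [-1, 1]`, `j = 0, …, m - 1`; the midpoint if `m = 1`. -/
def ccNode (lo hi : ℝ) (m : ℕ) (j : Fin m) : ℝ :=
  if m = 1 then (lo + hi) / 2
  else (lo + hi) / 2 - (hi - lo) / 2 * Real.cos (Real.pi * (j : ℝ) / ((m : ℝ) - 1))

section Interpolation

variable {N : ℕ} {E : Type*} [AddCommGroup E] [Module ℝ E]

/-- The Lagrange interpolant `𝒰ₙ^m` at the `m` Clenshaw–Curtis nodes, acting on the `n`-th
variable; it is `0` if `m = 0`. -/
def interp (lo hi : Fin N → ℝ) (n : Fin N) (m : ℕ) (v : (Fin N → ℝ) → E) :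
    (Fin N → ℝ) → E :=
  fun y => ∑ j : Fin m,
    (Lagrange.basis Finset.univ (ccNode (lo n) (hi n) m) j).eval (y n) •
      v (Function.update y n (ccNode (lo n) (hi n) m j))

/-- The detail operator `𝒰ₙ^{m(i)} - 𝒰ₙ^{m(i-1)}`, acting on the `n`-th variable (`i ≥ 1`). -/
def detail (lo hi : Fin N → ℝ) (n : Fin N) (i : ℕ) (v : (Fin N → ℝ) → E) :
    (Fin N → ℝ) → E :=
  interp lo hi n (level i) v - interp lo hi n (level (i - 1)) v

/-- The hierarchical surplus `Δ^{m(i)} = ⨂ₙ Δ^{m(iₙ)}`: the detail operators are applied one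
after the other, each in its own variable. -/
def surplus (lo hi : Fin N → ℝ) (i : Fin N → ℕ) (v : (Fin N → ℝ) → E) :
    (Fin N → ℝ) → E :=
  (List.finRange N).foldr (fun n w => detail lo hi n (i n) w) v

/-- The sparse grid interpolant `S_I[v] = ∑_{i ∈ I} Δ^{m(i)} v`. -/
def sparseInterp (lo hi : Fin N → ℝ) (I : Finset (Fin N → ℕ)) (v : (Fin N → ℝ) → E) :
    (Fin N → ℝ) → E :=
  fun y => ∑ i ∈ I, surplus lo hi i v y

end Interpolation

/-! ### Multi-index sets

Multi-indices have entries `≥ 1`. -/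

section MultiIndex

variable {N : ℕ}

/-- `I` is downward closed: `i - eₙ ∈ I` for all `i ∈ I` and all `n` with `iₙ > 1`. -/
def IsDownwardClosed (I : Finset (Fin N → ℕ)) : Prop :=
  ∀ i ∈ I, ∀ n, 1 < i n → i - Pi.single n 1 ∈ I

/-- The margin of `I`: all multi-indices outside `I` of the form `j + eₙ` with `j ∈ I`. -/
def margin (I : Finset (Fin N → ℕ)) : Finset (Fin N → ℕ) :=
  (I.biUnion fun j => Finset.univ.image fun n => j + Pi.single n 1) \ I

open Classical in
/-- `A_{i,I}`: the smallest subset of the margin that contains `i` and whose union with `I` is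
downward closed. -/
def closureInMargin (i : Fin N → ℕ) (I : Finset (Fin N → ℕ)) : Finset (Fin N → ℕ) :=
  (margin I).filter fun j =>
    ∀ B ⊆ margin I, i ∈ B → IsDownwardClosed (I ∪ B) → j ∈ B

/-- The axis-aligned rectangle `R_i = {j : 1 ≤ jₙ ≤ iₙ for all n}`. -/
def rectangle (i : Fin N → ℕ) : Finset (Fin N → ℕ) := Finset.Icc 1 i

end MultiIndex

/-! ### The adaptive algorithm with workless profit -/

section Algorithm

variable {d N : ℕ} {D : Set (Space d)}

/-- The pointwise estimator `ζ_{i,I} = ‖Δ^{m(i)}(a ∇S_I[u])‖_{L^∞(Γ, L²(D))}`. The function under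
the norm is a polynomial in `y`, so that the norm is a finite supremum over `Γ`. -/
def estimator (lo hi : Fin N → ℝ) (a₀ : LInf D) (a : Fin N → LInf D)
    (u : (Fin N → ℝ) → H10 D) (i : Fin N → ℕ) (I : Finset (Fin N → ℕ)) : ℝ :=
  ⨆ y : paramBox lo hi,
    ‖surplus lo hi i
      (fun y' => (coeff a₀ a y' • grad (sparseInterp lo hi I u y') : L2Vec D)) (y : Fin N → ℝ)‖

/-- The workless profit `𝒫_{i,I} = ∑_{j ∈ A_{i,I}} ζ_{j,I}`. -/
def worklessProfit (lo hi : Fin N → ℝ) (a₀ : LInf D) (a : Fin N → LInf D)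
    (u : (Fin N → ℝ) → H10 D) (i : Fin N → ℕ) (I : Finset (Fin N → ℕ)) : ℝ :=
  ∑ j ∈ closureInMargin i I, estimator lo hi a₀ a u j I

/-- `(I_ℓ)_{ℓ ≥ 1}`, `(i_ℓ)_{ℓ ≥ 0}` is a run of the adaptive stochastic collocation algorithm
driven by the workless profit, without a stopping criterion. Among the multi-indices of maximal
profit, ties are broken arbitrarily, except that a multi-index is not selected if another one of
maximal profit is componentwise at least as large. -/
structure IsWorklessRun (lo hi : Fin N → ℝ) (a₀ : LInf D) (a : Fin N → LInf D)
    (u : (Fin N → ℝ) → H10 D) (I : ℕ → Finset (Fin N → ℕ)) (i : ℕ → Fin N → ℕ) : Prop where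
  init_index : i 0 = 1
  init_set : I 1 = {1}
  mem_margin : ∀ ℓ, 0 < ℓ → i ℓ ∈ margin (I ℓ)
  profit_max : ∀ ℓ, 0 < ℓ → ∀ j ∈ margin (I ℓ),
    worklessProfit lo hi a₀ a u j (I ℓ) ≤ worklessProfit lo hi a₀ a u (i ℓ) (I ℓ)
  tie_break : ∀ ℓ, 0 < ℓ → ∀ j ∈ margin (I ℓ),
    worklessProfit lo hi a₀ a u j (I ℓ) = worklessProfit lo hi a₀ a u (i ℓ) (I ℓ) →
      i ℓ ≤ j → j = i ℓ
  step : ∀ ℓ, 0 < ℓ → I (ℓ + 1) = I ℓ ∪ closureInMargin (i ℓ) (I ℓ)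

end Algorithm

end SparseCollocation

end

/-! The workless profit of `j` sums nonnegative estimators over everything that has to be added
together with `j`. The margin of a rectangle `R_r` is the disjoint union of `N` faces, and for `j`
in the face of direction `n` the set `A_j` consists of the points of that face below `j`. Within a
face the profit is therefore largest at the corner `r + e_n`, and the tie-breaking rule forces the
corner. So each step turns `R_r` into `R_{r + e_n}` for one `n`, and the entries of `i_ℓ` add up to
`N + ℓ`.

The error bound combines three facts about rectangles.

Reliability (`amin_mul_normV_le_sum_worklessProfit`): as `a` is affine in `y`, the flux `a ∇S_I[u]`
is reproduced exactly by the details in `I` and its margin, and the interpolated flux satisfies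
Galerkin orthogonality. Coercivity then bounds the error by `1/amin` times the sum of the `N` corner
profits.

Decay (`exists_worklessProfit_le`): the profit of the corner `r + e_n` is at most `C e^{-σ m(r_n)}`.
On face `n` only the term `a_n y_n` survives the surplus, leaving a tensor product of univariate
operators. These are bounded on Chebyshev polynomials, by aliasing, and annihilate those of low
degree, while holomorphic functions have geometrically decaying Chebyshev coefficients.

Quasi-monotonicity (`normV_sub_sparseInterp_le`): enlarging a rectangle multiplies the error at most
by one plus a product of Lebesgue constants, which grow only linearly in the level.

By pigeonhole some entry `(i_ℓ)_n` is at least `1 + ℓ/N`. Go back to the last step at which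
direction `n` was enriched. Its corner won there, so all `N` corner profits were at most `C e^{-σ
m(k)}` with `k = (i_ℓ)_n - 1 ≥ ℓ/N`. Reliability bounds the error at that moment, quasi-monotonicity
and the inequality of arithmetic and geometric means carry it to `I_ℓ`, and `m(1 + ℓ/N) ≤ 2 m(k) +
1` yields the rate `σ/2`. -/

noncomputable section

namespace SparseCollocation

/-! ### Finite evaluation kernels and their tensor products -/

section Kernels

variable {N : ℕ} {E F : Type*} [AddCommGroup E] [Module ℝ E] [AddCommGroup F] [Module ℝ F]

/-- A univariate operator whose value at `t` is the finite combination of point evaluations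
`K (single t 1)`. Composition of the operators is multiplication in the opposite order. -/
abbrev PointKernel : Type := Module.End ℝ (ℝ →₀ ℝ)

/-- The action of a kernel on a function of one real variable. -/
def PointKernel.act (K : PointKernel) (g : ℝ → E) (t : ℝ) : E :=
  Finsupp.linearCombination ℝ g (K (Finsupp.single t 1))

/-- The action of a kernel on the `n`-th variable. -/
def lift (n : Fin N) : PointKernel →ₗ[ℝ] Module.End ℝ ((Fin N → ℝ) → E) where
  toFun K :=
    { toFun := fun v y => K.act (fun x => v (Function.update y n x)) (y n)
      map_add' := by
        intro v w
        ext y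
        simp [PointKernel.act, Finsupp.linearCombination_apply, Finsupp.sum,
          Finset.sum_add_distrib]
      map_smul' := by
        intro c v
        ext y
        simp [PointKernel.act, Finsupp.linearCombination_apply, Finsupp.sum, Finset.smul_sum,
          smul_comm c] }
  map_add' := by
    intro K K'
    ext v y
    simp [PointKernel.act]
  map_smul' := by
    intro c K
    ext v y
    simp [PointKernel.act]

theorem lift_apply (n : Fin N) (K : PointKernel) (v : (Fin N → ℝ) → E) (y : Fin N → ℝ) :
    lift n K v y = K.act (fun x => v (Function.update y n x)) (y n) := rfl

theorem PointKernel.act_eq_sum (K : PointKernel) (g : ℝ → E) (t : ℝ) :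
    K.act g t = ∑ x ∈ (K (Finsupp.single t 1)).support, K (Finsupp.single t 1) x • g x := by
  simp [PointKernel.act, Finsupp.linearCombination_apply, Finsupp.sum]

/-- A kernel moves point masses, so its action on functions is the transpose and reverses products.
In every product of kernels below, the left factor is the one applied to the function first. -/
theorem PointKernel.act_mul (K K' : PointKernel) (g : ℝ → E) (t : ℝ) :
    (K' * K).act g t = K.act (K'.act g) t := by
  have h : Finsupp.linearCombination ℝ (K'.act g) =
      (Finsupp.linearCombination ℝ g).comp K' := by
    ext x
    simp [PointKernel.act]
  simp only [PointKernel.act] at h ⊢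
  rw [h]
  rfl

theorem PointKernel.act_sub (K K' : PointKernel) (g : ℝ → E) (t : ℝ) :
    (K - K').act g t = K.act g t - K'.act g t := by
  simp [PointKernel.act]

theorem PointKernel.mul_sub (K A B : PointKernel) : K * (A - B) = K * A - K * B :=
  LinearMap.ext fun x => by
    rw [LinearMap.sub_apply, Module.End.mul_apply, LinearMap.sub_apply, map_sub,
      Module.End.mul_apply, Module.End.mul_apply]

theorem PointKernel.sub_self (K : PointKernel) : K - K = 0 :=
  LinearMap.ext fun x => by rw [LinearMap.sub_apply, _root_.sub_self, LinearMap.zero_apply]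

theorem PointKernel.act_one (g : ℝ → E) (t : ℝ) : (1 : PointKernel).act g t = g t := by
  simp [PointKernel.act]

theorem PointKernel.map_act (K : PointKernel) (φ : E →ₗ[ℝ] F) (g : ℝ → E) (t : ℝ) :
    φ (K.act g t) = K.act (fun x => φ (g x)) t := by
  simp [PointKernel.act_eq_sum]

theorem lift_mul (n : Fin N) (K K' : PointKernel) :
    (lift n K * lift n K' : Module.End ℝ ((Fin N → ℝ) → E)) = lift n (K' * K) := by
  ext v y
  rw [Module.End.mul_apply, lift_apply, lift_apply, PointKernel.act_mul]
  congr 1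
  ext x
  simp [lift_apply]

theorem lift_one (n : Fin N) : (lift n 1 : Module.End ℝ ((Fin N → ℝ) → E)) = 1 := by
  ext v y
  simp [lift_apply, PointKernel.act_one]

theorem lift_commute {n l : Fin N} (h : n ≠ l) (K K' : PointKernel) :
    Commute (lift n K : Module.End ℝ ((Fin N → ℝ) → E)) (lift l K') := by
  ext v y
  simp only [Module.End.mul_apply, lift_apply, PointKernel.act_eq_sum,
    Function.update_of_ne h, Function.update_of_ne h.symm, Finset.smul_sum]
  rw [Finset.sum_comm]
  refine Finset.sum_congr rfl fun x _ => Finset.sum_congr rfl fun x' _ => ?_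
  rw [smul_comm, Function.update_comm h]

theorem lift_sub (n : Fin N) (A B : PointKernel) (v : (Fin N → ℝ) → E) :
    lift n (A - B) v = lift n A v - lift n B v := by
  ext y
  rw [Pi.sub_apply, lift_apply, lift_apply, lift_apply, PointKernel.act_sub]

theorem lift_map (n : Fin N) (K : PointKernel) (φ : E →ₗ[ℝ] F) (v : (Fin N → ℝ) → E)
    (y : Fin N → ℝ) : φ (lift n K v y) = lift n K (fun y' => φ (v y')) y :=
  K.map_act φ _ _

/-- The product of the lifts of `K n` over the variables in the list. -/
def listOp (L : List (Fin N)) (K : Fin N → PointKernel) :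
    Module.End ℝ ((Fin N → ℝ) → E) :=
  (L.map fun n => lift n (K n)).prod

/-- The tensor product of univariate kernels, one in each variable. -/
def tensorOp (K : Fin N → PointKernel) : Module.End ℝ ((Fin N → ℝ) → E) :=
  listOp (List.finRange N) K

theorem listOp_nil (K : Fin N → PointKernel) :
    (listOp [] K : Module.End ℝ ((Fin N → ℝ) → E)) = 1 := rfl

theorem listOp_cons (n : Fin N) (L : List (Fin N)) (K : Fin N → PointKernel) :
    (listOp (n :: L) K : Module.End ℝ ((Fin N → ℝ) → E)) = lift n (K n) * listOp L K := by
  simp [listOp]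

theorem listOp_commute {n : Fin N} {L : List (Fin N)} (h : n ∉ L) (K' : PointKernel)
    (K : Fin N → PointKernel) :
    Commute (lift n K' : Module.End ℝ ((Fin N → ℝ) → E)) (listOp L K) := by
  induction L with
  | nil => exact Commute.one_right _
  | cons l L ih =>
    rw [List.mem_cons, not_or] at h
    rw [listOp_cons]
    exact (lift_commute h.1 _ _).mul_right (ih h.2)

/-- Lifts in distinct variables commute, so the factors of the two products can be paired variable
by variable. -/
theorem listOp_mul {L : List (Fin N)} (hL : L.Nodup) (K K' : Fin N → PointKernel) :
    (listOp L K * listOp L K' : Module.End ℝ ((Fin N → ℝ) → E)) =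
      listOp L fun n => K' n * K n := by
  induction L with
  | nil => simp [listOp_nil]
  | cons n L ih =>
    obtain ⟨h1, h2⟩ := List.nodup_cons.1 hL
    simp only [listOp_cons]
    rw [← ih h2, ← lift_mul, mul_assoc, ← mul_assoc _ (lift n (K' n)),
      ← (listOp_commute h1 _ _).eq]
    simp only [mul_assoc]

theorem tensorOp_mul (K K' : Fin N → PointKernel) :
    (tensorOp K * tensorOp K' : Module.End ℝ ((Fin N → ℝ) → E)) =
      tensorOp fun n => K' n * K n :=
  listOp_mul (List.nodup_finRange N) K K'

theorem listOp_update_one {n : Fin N} (K : PointKernel) {L : List (Fin N)} (hL : L.Nodup) :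
    (listOp L (Function.update 1 n K) : Module.End ℝ ((Fin N → ℝ) → E)) =
      if n ∈ L then lift n K else 1 := by
  induction L with
  | nil => simp [listOp_nil]
  | cons l L ih =>
    obtain ⟨h1, h2⟩ := List.nodup_cons.1 hL
    rw [listOp_cons, ih h2]
    by_cases h : n = l
    · subst h
      simp [h1]
    · simp [h, Function.update_of_ne (Ne.symm h), lift_one]

theorem tensorOp_update_one (n : Fin N) (K : PointKernel) :
    (tensorOp (Function.update 1 n K) : Module.End ℝ ((Fin N → ℝ) → E)) = lift n K := by
  rw [tensorOp, listOp_update_one K (List.nodup_finRange N), if_pos (List.mem_finRange n)]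

theorem lift_mul_tensorOp (n : Fin N) (K : PointKernel) (K' : Fin N → PointKernel) :
    (lift n K * tensorOp K' : Module.End ℝ ((Fin N → ℝ) → E)) =
      tensorOp (Function.update K' n (K' n * K)) := by
  rw [← tensorOp_update_one, tensorOp_mul]
  congr 1
  ext1 l
  by_cases h : l = n
  · subst h; simp
  · simp [Function.update_of_ne h]

theorem tensorOp_mul_lift (n : Fin N) (K : PointKernel) (K' : Fin N → PointKernel) :
    (tensorOp K' * lift n K : Module.End ℝ ((Fin N → ℝ) → E)) =
      tensorOp (Function.update K' n (K * K' n)) := by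
  rw [← tensorOp_update_one, tensorOp_mul]
  congr 1
  ext1 l
  by_cases h : l = n
  · subst h; simp
  · simp [Function.update_of_ne h]

/-- This form exhibits multilinearity in the factors, the source of `tensorOp_sum` and
`tensorOp_eq_zero`. -/
theorem tensorOp_eq_mkPiAlgebraFin (K : Fin N → PointKernel) :
    (tensorOp K : Module.End ℝ ((Fin N → ℝ) → E)) =
      MultilinearMap.mkPiAlgebraFin ℝ N (Module.End ℝ ((Fin N → ℝ) → E))
        fun n => lift n (K n) := by
  rw [MultilinearMap.mkPiAlgebraFin_apply, tensorOp, listOp, List.ofFn_eq_map]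

theorem tensorOp_sum (A : Fin N → Finset ℕ) (K : Fin N → ℕ → PointKernel) :
    (∑ j ∈ Fintype.piFinset A, tensorOp fun n => K n (j n)) =
      (tensorOp fun n => ∑ k ∈ A n, K n k : Module.End ℝ ((Fin N → ℝ) → E)) := by
  simp only [tensorOp_eq_mkPiAlgebraFin, map_sum]
  rw [MultilinearMap.map_sum_finset]

theorem tensorOp_eq_zero {K : Fin N → PointKernel} (n : Fin N) (h : K n = 0) :
    (tensorOp K : Module.End ℝ ((Fin N → ℝ) → E)) = 0 := by
  rw [tensorOp_eq_mkPiAlgebraFin]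
  exact MultilinearMap.map_coord_zero _ n (by simp [h])

theorem listOp_map (L : List (Fin N)) (K : Fin N → PointKernel) (φ : E →ₗ[ℝ] F)
    (v : (Fin N → ℝ) → E) (y : Fin N → ℝ) :
    φ (listOp L K v y) = listOp L K (fun y' => φ (v y')) y := by
  induction L generalizing y with
  | nil => rfl
  | cons n L ih =>
    rw [listOp_cons, listOp_cons, Module.End.mul_apply, Module.End.mul_apply, lift_map]
    simp only [ih]

/-- Only finite linear combinations of values occur, so every linear map passes through: the
gradient, multiplication by a coefficient, dual functionals. -/
theorem tensorOp_map (K : Fin N → PointKernel) (φ : E →ₗ[ℝ] F)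
    (v : (Fin N → ℝ) → E) (y : Fin N → ℝ) :
    φ (tensorOp K v y) = tensorOp K (fun y' => φ (v y')) y :=
  listOp_map _ K φ v y

end Kernels

/-! ### The doubling rule -/

theorem level_strictMono : StrictMono level := by
  refine strictMono_nat_of_lt_succ fun k => ?_
  match k with
  | 0 => simp [level]
  | 1 => simp [level]
  | k + 2 =>
    simp only [level]
    have : 2 ^ (k + 1 + 1) = 2 * 2 ^ (k + 1) := by ring
    have : 0 < 2 ^ (k + 1) := by positivity
    omega

theorem level_mono : Monotone level := level_strictMono.monotone

theorem le_level (k : ℕ) : k ≤ level k := level_strictMono.le_apply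

theorem level_pos {k : ℕ} (hk : 0 < k) : 0 < level k := hk.trans_le (le_level k)

/-! ### Clenshaw–Curtis interpolation in one variable -/

section Nodes

variable {lo hi : ℝ}

theorem ccNode_mem_Icc (h : lo ≤ hi) (m : ℕ) (j : Fin m) :
    ccNode lo hi m j ∈ Set.Icc lo hi := by
  unfold ccNode
  split_ifs
  · constructor <;> linarith
  · set x := Real.cos (Real.pi * (j : ℝ) / ((m : ℝ) - 1))
    have h1 : x ≤ 1 := Real.cos_le_one _
    have h2 : -1 ≤ x := Real.neg_one_le_cos _
    constructor <;> nlinarith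

theorem ccNode_injective (h : lo < hi) (m : ℕ) : Function.Injective (ccNode lo hi m) := by
  intro i j hij
  by_cases hm : m = 1
  · subst hm
    exact Subsingleton.elim _ _
  have hm2 : (1 : ℝ) < m := by
    have : 1 < m := by have := i.2; omega
    exact_mod_cast this
  simp only [ccNode, if_neg hm] at hij
  have hcos : Real.cos (Real.pi * (i : ℝ) / ((m : ℝ) - 1)) =
      Real.cos (Real.pi * (j : ℝ) / ((m : ℝ) - 1)) := by
    have : (hi - lo) / 2 ≠ 0 := by linarith
    apply mul_left_cancel₀ this
    linarith
  have hmem : ∀ k : Fin m, Real.pi * (k : ℝ) / ((m : ℝ) - 1) ∈ Set.Icc 0 Real.pi := by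
    intro k
    have hk : (k : ℝ) ≤ m - 1 := by
      have : (k : ℕ) + 1 ≤ m := k.2
      have : ((k : ℕ) : ℝ) + 1 ≤ m := by exact_mod_cast this
      linarith
    have := Real.pi_pos
    constructor
    · have : (0 : ℝ) < m - 1 := by linarith
      positivity
    · rw [div_le_iff₀ (by linarith)]
      gcongr
  have h2 := Real.injOn_cos (hmem i) (hmem j) hcos
  rw [div_left_inj' (by linarith), mul_right_inj' Real.pi_ne_zero] at h2
  exact Fin.ext (by exact_mod_cast h2)

/-- The kernel of Lagrange interpolation at the `m` Clenshaw–Curtis nodes. -/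
def interpKernel (lo hi : ℝ) (m : ℕ) : PointKernel :=
  Finsupp.linearCombination ℝ fun t => ∑ j : Fin m, Finsupp.single (ccNode lo hi m j)
    ((Lagrange.basis Finset.univ (ccNode lo hi m) j).eval t)

/-- The kernel of the detail operator. -/
def detailKernel (lo hi : ℝ) (i : ℕ) : PointKernel :=
  interpKernel lo hi (level i) - interpKernel lo hi (level (i - 1))

/-- The kernel of multiplication by the coordinate. -/
def coordKernel : PointKernel := Finsupp.linearCombination ℝ fun t => Finsupp.single t t

theorem interpKernel_single (lo hi : ℝ) (m : ℕ) (t c : ℝ) :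
    interpKernel lo hi m (Finsupp.single t c) = ∑ j : Fin m,
      Finsupp.single (ccNode lo hi m j)
        (c * (Lagrange.basis Finset.univ (ccNode lo hi m) j).eval t) := by
  simp [interpKernel, Finset.smul_sum]

theorem coordKernel_single (t c : ℝ) :
    coordKernel (Finsupp.single t c) = Finsupp.single t (c * t) := by
  simp [coordKernel]

theorem interpKernel_act {E : Type*} [AddCommGroup E] [Module ℝ E] (m : ℕ) (g : ℝ → E) (t : ℝ) :
    (interpKernel lo hi m).act g t = ∑ j : Fin m,
      (Lagrange.basis Finset.univ (ccNode lo hi m) j).eval t • g (ccNode lo hi m j) := by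
  simp [PointKernel.act, interpKernel_single]

theorem coordKernel_act {E : Type*} [AddCommGroup E] [Module ℝ E] (g : ℝ → E) (t : ℝ) :
    coordKernel.act g t = t • g t := by
  simp [PointKernel.act, coordKernel_single]

theorem sum_basis_eval_mul (h : lo < hi) {m : ℕ} {q : Polynomial ℝ} (hq : q.degree < m) (t : ℝ) :
    ∑ j : Fin m, (Lagrange.basis Finset.univ (ccNode lo hi m) j).eval t *
      q.eval (ccNode lo hi m j) = q.eval t := by
  have := Lagrange.eq_interpolate (s := Finset.univ) (v := ccNode lo hi m) (f := q)
    (ccNode_injective h m).injOn (by simpa using hq)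
  conv_rhs => rw [this, Lagrange.interpolate_apply]
  simp [Polynomial.eval_finsetSum, mul_comm]

theorem interpKernel_act_polynomial (h : lo < hi) {m : ℕ} {q : Polynomial ℝ}
    (hq : q.degree < m) (t : ℝ) :
    (interpKernel lo hi m).act (fun x => q.eval x) t = q.eval t := by
  simpa [interpKernel_act] using sum_basis_eval_mul h hq t

theorem degree_basis_ccNode (h : lo < hi) {m : ℕ} (j : Fin m) :
    (Lagrange.basis Finset.univ (ccNode lo hi m) j).degree = ((m - 1 : ℕ) : WithBot ℕ) := by
  have := Lagrange.degree_basis (s := Finset.univ) (v := ccNode lo hi m) (i := j)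
    (ccNode_injective h m).injOn (Finset.mem_univ _)
  simpa using this

theorem degree_basis_ccNode_lt (h : lo < hi) {m m' : ℕ} (hm : m ≤ m') (j : Fin m) :
    (Lagrange.basis Finset.univ (ccNode lo hi m) j).degree < m' := by
  rw [degree_basis_ccNode h]
  have := j.2
  exact_mod_cast (by omega : m - 1 < m')

/-- Interpolation at `m` nodes reproduces the polynomial of degree below `m'` left by the
interpolation applied first. -/
theorem interpKernel_mul_interpKernel (h : lo < hi) {m m' : ℕ} (hm : m' ≤ m) :
    interpKernel lo hi m' * interpKernel lo hi m = interpKernel lo hi m' := by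
  refine Finsupp.lhom_ext' fun t => LinearMap.ext_ring ?_
  simp only [LinearMap.comp_apply, Finsupp.lsingle_apply, Module.End.mul_apply,
    interpKernel_single, map_sum, one_mul]
  rw [Finset.sum_comm]
  refine Finset.sum_congr rfl fun i _ => ?_
  rw [← Finsupp.single_finsetSum, sum_basis_eval_mul h (degree_basis_ccNode_lt h hm i)]

/-- One spare degree absorbs the coordinate: `x` times an interpolant at `m'` nodes has degree at
most `m' < m`. -/
theorem interpKernel_mul_coordKernel_mul_interpKernel (h : lo < hi) {m m' : ℕ} (hm : m' < m) :
    interpKernel lo hi m' * coordKernel * interpKernel lo hi m =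
      interpKernel lo hi m' * coordKernel := by
  refine Finsupp.lhom_ext' fun t => LinearMap.ext_ring ?_
  simp only [LinearMap.comp_apply, Finsupp.lsingle_apply, Module.End.mul_apply,
    interpKernel_single, coordKernel_single, map_sum, one_mul]
  rw [Finset.sum_comm]
  refine Finset.sum_congr rfl fun i _ => ?_
  rw [← Finsupp.single_finsetSum]
  have hdeg : (Polynomial.X * Lagrange.basis Finset.univ (ccNode lo hi m') i).degree <
      (m : WithBot ℕ) := by
    rw [Polynomial.degree_mul, Polynomial.degree_X, degree_basis_ccNode h]
    have := i.2
    exact_mod_cast (by omega : 1 + (m' - 1) < m)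
  have := sum_basis_eval_mul h hdeg t
  simp only [Polynomial.eval_mul, Polynomial.eval_X, ← mul_assoc] at this
  rw [this, mul_comm]

theorem interpKernel_single_ccNode (h : lo < hi) {m : ℕ} (j : Fin m) (c : ℝ) :
    interpKernel lo hi m (Finsupp.single (ccNode lo hi m j) c) =
      Finsupp.single (ccNode lo hi m j) c := by
  rw [interpKernel_single, Finset.sum_eq_single j]
  · rw [Lagrange.eval_basis_self (ccNode_injective h m).injOn (Finset.mem_univ _), mul_one]
  · intro i _ hij
    rw [Lagrange.eval_basis_of_ne hij (Finset.mem_univ _), mul_zero, Finsupp.single_zero]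
  · simp

/-- Interpolation sees only nodal values, where the inner interpolant agrees with the function; no
degree count is involved. -/
theorem interpKernel_mul_coordKernel_mul_self (h : lo < hi) (m : ℕ) :
    interpKernel lo hi m * coordKernel * interpKernel lo hi m =
      coordKernel * interpKernel lo hi m := by
  refine Finsupp.lhom_ext' fun t => LinearMap.ext_ring ?_
  simp only [LinearMap.comp_apply, Finsupp.lsingle_apply, Module.End.mul_apply,
    interpKernel_single lo hi m t, coordKernel_single, map_sum, one_mul,
    interpKernel_single_ccNode h]

theorem interpKernel_mul_detailKernel (h : lo < hi) {m k : ℕ} (hm : m ≤ level (k - 1)) :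
    interpKernel lo hi m * detailKernel lo hi k = 0 := by
  rw [detailKernel, PointKernel.mul_sub, interpKernel_mul_interpKernel h hm,
    interpKernel_mul_interpKernel h (hm.trans (level_mono (Nat.sub_le k 1))), PointKernel.sub_self]

theorem interpKernel_zero : interpKernel lo hi 0 = 0 := by
  refine Finsupp.lhom_ext' fun t => LinearMap.ext_ring ?_
  simp [interpKernel_single]

theorem sum_detailKernel (lo hi : ℝ) (i : ℕ) :
    ∑ k ∈ Finset.Icc 1 i, detailKernel lo hi k = interpKernel lo hi (level i) := by
  induction i with
  | zero => simp [level, interpKernel_zero]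
  | succ i ih =>
    rw [Finset.sum_Icc_succ_top (by omega), ih, detailKernel, Nat.add_sub_cancel]
    exact LinearMap.ext fun x => by simp

end Nodes

/-! ### The sparse grid operators as tensor products of kernels -/

section Operators

variable {N : ℕ} {E : Type*} [AddCommGroup E] [Module ℝ E] {lo hi : Fin N → ℝ}

theorem interp_eq_lift (n : Fin N) (m : ℕ) (v : (Fin N → ℝ) → E) :
    interp lo hi n m v = lift n (interpKernel (lo n) (hi n) m) v := by
  ext y
  rw [lift_apply, interpKernel_act]
  rfl

theorem detail_eq_lift (n : Fin N) (i : ℕ) (v : (Fin N → ℝ) → E) :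
    detail lo hi n i v = lift n (detailKernel (lo n) (hi n) i) v := by
  rw [detail, detailKernel, lift_sub, interp_eq_lift, interp_eq_lift]

/-- The tensor product of the detail kernels. -/
def detailKernels (lo hi : Fin N → ℝ) (i : Fin N → ℕ) (n : Fin N) : PointKernel :=
  detailKernel (lo n) (hi n) (i n)

/-- The tensor product of the interpolation kernels. -/
def interpKernels (lo hi : Fin N → ℝ) (i : Fin N → ℕ) (n : Fin N) : PointKernel :=
  interpKernel (lo n) (hi n) (level (i n))

theorem surplus_eq_tensorOp (i : Fin N → ℕ) (v : (Fin N → ℝ) → E) :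
    surplus lo hi i v = tensorOp (detailKernels lo hi i) v := by
  unfold surplus tensorOp
  induction List.finRange N with
  | nil => rfl
  | cons n L ih =>
    rw [List.foldr_cons, ih, listOp_cons, Module.End.mul_apply, detail_eq_lift]
    rfl

theorem rectangle_eq_piFinset (i : Fin N → ℕ) :
    rectangle i = Fintype.piFinset fun n => Finset.Icc 1 (i n) := by
  ext j
  simp [rectangle, Pi.le_def, forall_and]

/-- The details telescope in each variable, and multilinearity turns the sum over the box into the
tensor product of the univariate sums. -/
theorem sparseInterp_rectangle (i : Fin N → ℕ) (v : (Fin N → ℝ) → E) :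
    sparseInterp lo hi (rectangle i) v = tensorOp (interpKernels lo hi i) v := by
  have h : (tensorOp (interpKernels lo hi i) : Module.End ℝ ((Fin N → ℝ) → E)) =
      ∑ j ∈ rectangle i, tensorOp (detailKernels lo hi j) := by
    rw [rectangle_eq_piFinset]
    unfold detailKernels
    rw [tensorOp_sum _ fun n k => detailKernel (lo n) (hi n) k]
    simp only [sum_detailKernel]
    rfl
  ext y
  simp [sparseInterp, surplus_eq_tensorOp, h]

end Operators

/-! ### Chebyshev polynomials on an interval and aliasing -/

section Chebyshev

open Polynomial

variable {lo hi : ℝ}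

/-- The Chebyshev polynomial `T_k`, transported to the interval `[lo, hi]`. -/
def chebyshevOn (lo hi : ℝ) (k : ℤ) : ℝ[X] :=
  (Chebyshev.T ℝ k).comp (C (2 / (hi - lo)) * (X - C ((lo + hi) / 2)))

theorem chebyshevOn_eval (lo hi : ℝ) (k : ℤ) (t : ℝ) :
    (chebyshevOn lo hi k).eval t =
      (Chebyshev.T ℝ k).eval (2 / (hi - lo) * (t - (lo + hi) / 2)) := by
  simp [chebyshevOn]

theorem chebyshevOn_eval_cos (h : lo < hi) (k : ℤ) (θ : ℝ) :
    (chebyshevOn lo hi k).eval ((lo + hi) / 2 + (hi - lo) / 2 * Real.cos θ) =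
      Real.cos (k * θ) := by
  have : hi - lo ≠ 0 := by linarith
  rw [chebyshevOn_eval, add_sub_cancel_left]
  rw [show 2 / (hi - lo) * ((hi - lo) / 2 * Real.cos θ) = Real.cos θ by field_simp]
  exact Chebyshev.T_real_cos θ k

theorem exists_cos_eq_of_mem_Icc (h : lo < hi) {t : ℝ} (ht : t ∈ Set.Icc lo hi) :
    ∃ θ, t = (lo + hi) / 2 + (hi - lo) / 2 * Real.cos θ := by
  have h0 : 0 < hi - lo := by linarith
  refine ⟨Real.arccos (2 / (hi - lo) * (t - (lo + hi) / 2)), ?_⟩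
  rw [Real.cos_arccos]
  · field_simp
    ring
  · rw [div_mul_eq_mul_div, le_div_iff₀ h0]
    linarith [ht.1]
  · rw [div_mul_eq_mul_div, div_le_iff₀ h0]
    linarith [ht.2]

theorem abs_chebyshevOn_eval_le (h : lo < hi) (k : ℤ) {t : ℝ} (ht : t ∈ Set.Icc lo hi) :
    |(chebyshevOn lo hi k).eval t| ≤ 1 := by
  obtain ⟨θ, rfl⟩ := exists_cos_eq_of_mem_Icc h ht
  rw [chebyshevOn_eval_cos h]
  exact Real.abs_cos_le_one _

theorem degree_chebyshevOn_le (lo hi : ℝ) (k : ℤ) :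
    (chebyshevOn lo hi k).degree ≤ (k.natAbs : ℕ) := by
  refine degree_le_of_natDegree_le ?_
  refine natDegree_comp_le.trans ?_
  rw [Chebyshev.natDegree_T]
  have : (C (2 / (hi - lo)) * (X - C ((lo + hi) / 2)) : ℝ[X]).natDegree ≤ 1 := by
    refine natDegree_C_mul_le _ _ |>.trans ?_
    exact natDegree_X_sub_C_le _
  simpa using Nat.mul_le_mul_left k.natAbs this

theorem degree_chebyshevOn_lt (lo hi : ℝ) {k : ℤ} {m : ℕ} (hk : k.natAbs < m) :
    (chebyshevOn lo hi k).degree < (m : WithBot ℕ) :=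
  (degree_chebyshevOn_le lo hi k).trans_lt (by exact_mod_cast hk)

theorem chebyshevOn_zero (lo hi : ℝ) : chebyshevOn lo hi 0 = 1 := by
  simp [chebyshevOn]

/-- The three-term recurrence on the interval. It controls multiplication by the coordinate with
constants independent of `k`. -/
theorem mul_chebyshevOn_eval (h : lo < hi) (k : ℤ) (t : ℝ) :
    t * (chebyshevOn lo hi k).eval t = (lo + hi) / 2 * (chebyshevOn lo hi k).eval t +
      (hi - lo) / 4 * ((chebyshevOn lo hi (k + 1)).eval t +
        (chebyshevOn lo hi (k - 1)).eval t) := by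
  have : hi - lo ≠ 0 := by linarith
  simp only [chebyshevOn_eval, Chebyshev.T_add_one ℝ k]
  simp only [eval_sub, eval_mul, eval_X, eval_ofNat]
  field_simp
  ring

theorem ccNode_eq_cos {m : ℕ} (hm : 2 ≤ m) (j : Fin m) :
    ccNode lo hi m j = (lo + hi) / 2 + (hi - lo) / 2 *
      Real.cos (((m - 1 - j : ℕ) : ℝ) * Real.pi / ((m - 1 : ℕ) : ℝ)) := by
  have hj : (j : ℕ) ≤ m - 1 := by have := j.2; omega
  have hm' : ((m - 1 : ℕ) : ℝ) = m - 1 := by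
    rw [Nat.cast_sub (by omega)]; simp
  have h0 : (m : ℝ) - 1 ≠ 0 := by
    have : (2 : ℝ) ≤ m := by exact_mod_cast hm
    linarith
  rw [ccNode, if_neg (by omega), Nat.cast_sub hj, hm',
    show ((m : ℝ) - 1 - j) * Real.pi / (m - 1) = Real.pi - Real.pi * j / (m - 1) by
      field_simp, Real.cos_pi_sub]
  ring

/-- On the grid `iπ/n` the frequency `k` matters only modulo `2n` and up to sign, so it folds into
`[0, n]`. -/
theorem exists_natAbs_le_cos_eq {n : ℕ} (hn : 0 < n) (k : ℤ) :
    ∃ k' : ℤ, k'.natAbs ≤ n ∧ ∀ i : ℕ,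
      Real.cos (k * ((i : ℝ) * Real.pi / n)) = Real.cos (k' * ((i : ℝ) * Real.pi / n)) := by
  have hn' : (n : ℝ) ≠ 0 := by positivity
  set r := k % (2 * n) with hr
  set q := k / (2 * n) with hq
  have hkr : k = r + 2 * n * q := (Int.emod_add_mul_ediv k (2 * n)).symm
  have h0 : 0 ≤ r := Int.emod_nonneg _ (by omega)
  have h1 : r < 2 * n := Int.emod_lt_of_pos _ (by omega)
  have key : ∀ i : ℕ, Real.cos (k * ((i : ℝ) * Real.pi / n)) =
      Real.cos (r * ((i : ℝ) * Real.pi / n)) := by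
    intro i
    have : (k : ℝ) * ((i : ℝ) * Real.pi / n) =
        r * ((i : ℝ) * Real.pi / n) + ((q * i : ℤ) : ℝ) * (2 * Real.pi) := by
      have : (k : ℝ) = r + 2 * n * q := by exact_mod_cast hkr
      rw [this]
      push_cast
      field_simp
    rw [this, Real.cos_add_int_mul_two_pi]
  by_cases hrn : r ≤ n
  · exact ⟨r, by omega, key⟩
  · refine ⟨2 * n - r, by omega, fun i => ?_⟩
    rw [key]
    have : ((2 * n - r : ℤ) : ℝ) * ((i : ℝ) * Real.pi / n) =
        ((i : ℤ) : ℝ) * (2 * Real.pi) - r * ((i : ℝ) * Real.pi / n) := by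
      push_cast
      field_simp
    rw [this, Real.cos_int_mul_two_pi_sub]

/-- Aliasing: the interpolant of a Chebyshev polynomial at Clenshaw–Curtis nodes is a multiple
of a Chebyshev polynomial. -/
theorem exists_interpKernel_act_chebyshevOn (h : lo < hi) {m : ℕ} (hm : 0 < m) (k : ℤ) :
    ∃ (c : ℝ) (k' : ℤ), |c| ≤ 1 ∧ ∀ t,
      (interpKernel lo hi m).act (fun x => (chebyshevOn lo hi k).eval x) t =
        c * (chebyshevOn lo hi k').eval t := by
  by_cases hm1 : m = 1
  · subst hm1
    -- With a single node the interpolant is the constant nodal value.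
    refine ⟨(chebyshevOn lo hi k).eval (ccNode lo hi 1 0), 0,
      abs_chebyshevOn_eval_le h k (ccNode_mem_Icc h.le 1 0), fun t => ?_⟩
    simp [interpKernel_act, chebyshevOn_zero]
  -- The folded frequency is at most `m - 1`, so `T_{k'}` is its own interpolant, and it agrees with
  -- `T_k` at all nodes.
  · obtain ⟨k', hk', hcos⟩ := exists_natAbs_le_cos_eq (n := m - 1) (by omega) k
    refine ⟨1, k', by simp, fun t => ?_⟩
    have hdeg : (chebyshevOn lo hi k').degree < (m : WithBot ℕ) :=
      degree_chebyshevOn_lt lo hi (by omega)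
    rw [one_mul, ← interpKernel_act_polynomial h hdeg t,
      interpKernel_act, interpKernel_act]
    refine Finset.sum_congr rfl fun j _ => ?_
    rw [ccNode_eq_cos (by omega), chebyshevOn_eval_cos h, chebyshevOn_eval_cos h, hcos]

/-- Thanks to aliasing no Lebesgue constant enters, and the decay estimates carry no factor growing
with the level. -/
theorem abs_interpKernel_act_chebyshevOn_le (h : lo < hi) (m : ℕ) (k : ℤ) {t : ℝ}
    (ht : t ∈ Set.Icc lo hi) :
    |(interpKernel lo hi m).act (fun x => (chebyshevOn lo hi k).eval x) t| ≤ 1 := by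
  rcases Nat.eq_zero_or_pos m with rfl | hm
  · simp [interpKernel_act]
  obtain ⟨c, k', hc, hk'⟩ := exists_interpKernel_act_chebyshevOn h hm k
  rw [hk', abs_mul]
  exact mul_le_one₀ hc (abs_nonneg _) (abs_chebyshevOn_eval_le h k' ht)

theorem abs_detailKernel_act_chebyshevOn_le (h : lo < hi) (i : ℕ) (k : ℤ) {t : ℝ}
    (ht : t ∈ Set.Icc lo hi) :
    |(detailKernel lo hi i).act (fun x => (chebyshevOn lo hi k).eval x) t| ≤ 2 := by
  rw [detailKernel, PointKernel.act_sub]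
  refine (abs_sub _ _).trans ?_
  linarith [abs_interpKernel_act_chebyshevOn_le h (level i) k ht,
    abs_interpKernel_act_chebyshevOn_le h (level (i - 1)) k ht]

theorem detailKernel_act_polynomial (h : lo < hi) {i : ℕ} {q : ℝ[X]}
    (hq : q.degree < level (i - 1)) (t : ℝ) :
    (detailKernel lo hi i).act (fun x => q.eval x) t = 0 := by
  rw [detailKernel, PointKernel.act_sub, interpKernel_act_polynomial h hq,
    interpKernel_act_polynomial h (hq.trans_le ?_), sub_self]
  exact_mod_cast level_mono (Nat.sub_le i 1)

theorem PointKernel.act_smul_fun {E : Type*} [AddCommGroup E] [Module ℝ E] (K : PointKernel)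
    (c : ℝ) (g : ℝ → E) (t : ℝ) : K.act (fun x => c • g x) t = c • K.act g t := by
  simp [PointKernel.act_eq_sum, Finset.smul_sum, smul_comm c]

theorem PointKernel.act_add_fun {E : Type*} [AddCommGroup E] [Module ℝ E] (K : PointKernel)
    (f g : ℝ → E) (t : ℝ) : K.act (fun x => f x + g x) t = K.act f t + K.act g t := by
  simp [PointKernel.act_eq_sum, Finset.sum_add_distrib]

/-- The composition of a detail operator with an interpolation operator of at least the same
level is bounded on Chebyshev polynomials. -/
theorem abs_interp_detail_act_chebyshevOn_le (h : lo < hi) {i j : ℕ} (hi' : 0 < i) (k : ℤ)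
    {t : ℝ} (ht : t ∈ Set.Icc lo hi) :
    |(interpKernel lo hi (level i) * detailKernel lo hi j).act
      (fun x => (chebyshevOn lo hi k).eval x) t| ≤ 2 := by
  obtain ⟨c, k', hc, hk'⟩ := exists_interpKernel_act_chebyshevOn h (level_pos hi') k
  rw [PointKernel.act_mul, funext hk']
  have := (detailKernel lo hi j).act_smul_fun c (fun x => (chebyshevOn lo hi k').eval x) t
  simp only [smul_eq_mul] at this
  rw [this, abs_mul]
  have h2 := abs_detailKernel_act_chebyshevOn_le h j k' ht
  calc |c| * _ ≤ 1 * 2 := mul_le_mul hc h2 (abs_nonneg _) zero_le_one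
    _ = 2 := one_mul 2

theorem interp_detail_act_chebyshevOn_eq_zero (h : lo < hi) {i j : ℕ} (hij : j ≤ i) {k : ℤ}
    (hk : k.natAbs < level (j - 1)) (t : ℝ) :
    (interpKernel lo hi (level i) * detailKernel lo hi j).act
      (fun x => (chebyshevOn lo hi k).eval x) t = 0 := by
  have h1 := interpKernel_act_polynomial h (m := level i) (q := chebyshevOn lo hi k)
    (degree_chebyshevOn_lt lo hi (hk.trans_le (level_mono (by omega))))
  rw [PointKernel.act_mul, funext h1,
    detailKernel_act_polynomial h (degree_chebyshevOn_lt lo hi hk)]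

/-- After aliasing, the recurrence splits `x T_{k'}` into three terms, and the detail costs a factor
2 on each: `2 · |lo + hi| / 2 + 2 · 2 · (hi - lo) / 4`. -/
theorem abs_interp_coord_detail_act_chebyshevOn_le (h : lo < hi) {i j : ℕ} (hi' : 0 < i) (k : ℤ)
    {t : ℝ} (ht : t ∈ Set.Icc lo hi) :
    |(interpKernel lo hi (level i) * coordKernel * detailKernel lo hi j).act
      (fun x => (chebyshevOn lo hi k).eval x) t| ≤ |lo + hi| + (hi - lo) := by
  obtain ⟨c, k', hc, hk'⟩ := exists_interpKernel_act_chebyshevOn h (level_pos hi') k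
  have h1 : (coordKernel.act ((interpKernel lo hi (level i)).act
      (fun x => (chebyshevOn lo hi k).eval x))) = fun x =>
        (c * ((lo + hi) / 2)) • (chebyshevOn lo hi k').eval x +
      ((c * ((hi - lo) / 4)) • (chebyshevOn lo hi (k' + 1)).eval x +
        (c * ((hi - lo) / 4)) • (chebyshevOn lo hi (k' - 1)).eval x) := by
    ext x
    rw [coordKernel_act, hk', smul_eq_mul, mul_left_comm, mul_chebyshevOn_eval h]
    simp only [smul_eq_mul]
    ring
  rw [PointKernel.act_mul, show (interpKernel lo hi (level i) * coordKernel).act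
    (fun x => (chebyshevOn lo hi k).eval x) = coordKernel.act ((interpKernel lo hi (level i)).act
      (fun x => (chebyshevOn lo hi k).eval x)) from ?_, h1]
  · rw [PointKernel.act_add_fun, PointKernel.act_add_fun, PointKernel.act_smul_fun,
      PointKernel.act_smul_fun, PointKernel.act_smul_fun]
    simp only [smul_eq_mul]
    have b0 := abs_detailKernel_act_chebyshevOn_le h j k' ht
    have b1 := abs_detailKernel_act_chebyshevOn_le h j (k' + 1) ht
    have b2 := abs_detailKernel_act_chebyshevOn_le h j (k' - 1) ht
    have c0 : |c * ((lo + hi) / 2)| ≤ |lo + hi| / 2 := by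
      rw [abs_mul, abs_div, abs_two]
      exact mul_le_of_le_one_left (by positivity) hc
    have c1 : |c * ((hi - lo) / 4)| ≤ (hi - lo) / 4 := by
      rw [abs_mul, abs_of_pos (by linarith : 0 < (hi - lo) / 4)]
      exact mul_le_of_le_one_left (by linarith) hc
    rw [← add_assoc]
    refine (abs_add_three _ _ _).trans ?_
    have d0 := mul_le_mul c0 b0 (abs_nonneg _) (by positivity)
    have d1 := mul_le_mul c1 b1 (abs_nonneg _) (by linarith)
    have d2 := mul_le_mul c1 b2 (abs_nonneg _) (by linarith)
    rw [← abs_mul] at d0 d1 d2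
    linarith
  · exact funext fun x => PointKernel.act_mul _ _ _ _

/-- Interpolation leaves `T_k` unchanged, and `x T_k` is still reproduced by both parts of the
detail. The degree spent on `x` is the `- 1` in the exponent of `boundOn_interp_coord_detail`. -/
theorem interp_coord_detail_act_chebyshevOn_eq_zero (h : lo < hi) {i : ℕ} {k : ℤ}
    (hk : k.natAbs + 1 < level i) (t : ℝ) :
    (interpKernel lo hi (level i) * coordKernel * detailKernel lo hi (i + 1)).act
      (fun x => (chebyshevOn lo hi k).eval x) t = 0 := by
  have h1 : (interpKernel lo hi (level i) * coordKernel).act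
      (fun x => (chebyshevOn lo hi k).eval x) =
      fun x => (X * chebyshevOn lo hi k).eval x := by
    ext x
    rw [PointKernel.act_mul, coordKernel_act,
      interpKernel_act_polynomial h (degree_chebyshevOn_lt lo hi (by omega))]
    simp
  rw [PointKernel.act_mul, h1, detailKernel_act_polynomial h]
  rw [degree_mul, degree_X, Nat.add_sub_cancel, add_comm]
  refine (add_le_add_left (degree_chebyshevOn_le lo hi k) 1).trans_lt ?_
  exact_mod_cast hk

end Chebyshev

/-! ### Chebyshev series of functions that are holomorphic near an interval -/

section ChebyshevSeries

/-- The open strip of width `τ` around `[lo, hi]`. -/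
def openStrip (lo hi τ : ℝ) : Set ℂ :=
  {z | Metric.infDist z ((fun t : ℝ => (t : ℂ)) '' Set.Icc lo hi) < τ}

/-- The parameter `ρ` of the largest Bernstein ellipse inside the strip. -/
def ellipseParam (lo hi τ : ℝ) : ℝ :=
  2 * τ / (hi - lo) + √(1 + 4 * τ ^ 2 / (hi - lo) ^ 2)

variable {lo hi τ : ℝ}

theorem one_lt_ellipseParam (h : lo < hi) (hτ : 0 < τ) : 1 < ellipseParam lo hi τ := by
  have h1 : 0 < 2 * τ / (hi - lo) := div_pos (by linarith) (by linarith)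
  have h2 : 1 ≤ √(1 + 4 * τ ^ 2 / (hi - lo) ^ 2) := by
    rw [Real.one_le_sqrt]
    have : 0 ≤ 4 * τ ^ 2 / (hi - lo) ^ 2 := by positivity
    linarith
  unfold ellipseParam
  linarith

/-- The left-hand side is the minor semi-axis of the ellipse with foci `lo`, `hi`; with `s = 2τ/(hi
- lo)` one has `ρ⁻¹ = √(1 + s²) - s`. -/
theorem ellipseParam_sub_inv (h : lo < hi) (hτ : 0 < τ) :
    (ellipseParam lo hi τ - (ellipseParam lo hi τ)⁻¹) * ((hi - lo) / 4) = τ := by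
  have h0 := one_lt_ellipseParam h hτ
  set s := 2 * τ / (hi - lo) with hs
  have hsq : √(1 + 4 * τ ^ 2 / (hi - lo) ^ 2) = √(1 + s ^ 2) := by
    congr 2
    rw [hs, div_pow]
    ring
  have hρ : ellipseParam lo hi τ = s + √(1 + s ^ 2) := by rw [ellipseParam, hsq]
  have hsqrt : √(1 + s ^ 2) ^ 2 = 1 + s ^ 2 := Real.sq_sqrt (by positivity)
  have hinv : (ellipseParam lo hi τ)⁻¹ = √(1 + s ^ 2) - s := by
    apply inv_eq_of_mul_eq_one_right
    rw [hρ]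
    linear_combination hsqrt
  rw [hinv, hρ, hs]
  have : hi - lo ≠ 0 := by linarith
  field_simp
  ring

/-- The Joukowski map onto ellipses with foci `lo` and `hi`. -/
def joukowski (lo hi : ℝ) (z : ℂ) : ℂ :=
  ((lo + hi) / 2 : ℝ) + ((hi - lo) / 4 : ℝ) * (z + z⁻¹)

theorem joukowski_exp (lo hi θ : ℝ) :
    joukowski lo hi (Complex.exp (θ * Complex.I)) =
      (((lo + hi) / 2 + (hi - lo) / 2 * Real.cos θ : ℝ) : ℂ) := by
  rw [joukowski, ← Complex.exp_neg]
  push_cast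
  rw [Complex.cos]
  rw [neg_mul]
  ring

theorem node_mem_Icc (h : lo < hi) (θ : ℝ) :
    (lo + hi) / 2 + (hi - lo) / 2 * Real.cos θ ∈ Set.Icc lo hi := by
  have h1 := Real.cos_le_one θ
  have h2 := Real.neg_one_le_cos θ
  constructor <;> nlinarith

theorem norm_joukowski_sub_le (h : lo < hi) (R θ : ℝ) :
    ‖joukowski lo hi (R * Complex.exp (θ * Complex.I)) -
      (((lo + hi) / 2 + (hi - lo) / 2 * Real.cos θ : ℝ) : ℂ)‖ ≤
      (hi - lo) / 4 * (|R - 1| + |R⁻¹ - 1|) := by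
  rw [← joukowski_exp]
  set e := Complex.exp (θ * Complex.I) with he
  have hn : ‖e‖ = 1 := Complex.norm_exp_ofReal_mul_I θ
  have : joukowski lo hi (R * e) - joukowski lo hi e =
      ((hi - lo) / 4 : ℝ) * (((R - 1 : ℝ) : ℂ) * e + ((R⁻¹ - 1 : ℝ) : ℂ) * e⁻¹) := by
    simp only [joukowski, mul_inv]
    push_cast
    ring
  rw [this, norm_mul, Complex.norm_real, Real.norm_of_nonneg (by linarith)]
  refine mul_le_mul_of_nonneg_left ((norm_add_le _ _).trans ?_) (by linarith)
  rw [norm_mul, norm_mul, norm_inv, hn, Complex.norm_real, Complex.norm_real]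
  simp

/-- The image of `R e^{iθ}` is compared with that of `e^{iθ}`, a point of the interval. Their
distance is at most `|R - R⁻¹| (hi - lo) / 4`, which is below `τ`. -/
theorem joukowski_mem_openStrip (h : lo < hi) (hτ : 0 < τ) {z : ℂ}
    (h1 : (ellipseParam lo hi τ)⁻¹ < ‖z‖) (h2 : ‖z‖ < ellipseParam lo hi τ) :
    joukowski lo hi z ∈ openStrip lo hi τ := by
  have hρ := one_lt_ellipseParam h hτ
  set ρ := ellipseParam lo hi τ with hρdef
  have hinv : ρ⁻¹ < 1 := inv_lt_one_of_one_lt₀ hρ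
  set R := ‖z‖ with hRdef
  have hR : 0 < R := (inv_pos.2 (by linarith)).trans h1
  obtain ⟨θ, hz⟩ : ∃ θ : ℝ, z = R * Complex.exp (θ * Complex.I) :=
    ⟨z.arg, (Complex.norm_mul_exp_arg_mul_I z).symm⟩
  have hmem : ((((lo + hi) / 2 + (hi - lo) / 2 * Real.cos θ : ℝ) : ℝ) : ℂ) ∈
      (fun t : ℝ => (t : ℂ)) '' Set.Icc lo hi := ⟨_, node_mem_Icc h θ, rfl⟩
  refine (Metric.infDist_le_dist_of_mem hmem).trans_lt ?_
  rw [dist_eq_norm]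
  conv_lhs => rw [hz]
  refine (norm_joukowski_sub_le h R θ).trans_lt ?_
  rw [← ellipseParam_sub_inv h hτ, ← hρdef, mul_comm]
  refine mul_lt_mul_of_pos_right ?_ (by linarith)
  have hR2 : R⁻¹ < ρ := by
    rw [inv_lt_comm₀ hR (by linarith)]
    exact h1
  have hR3 : ρ⁻¹ < R⁻¹ := (inv_lt_inv₀ (by linarith) hR).2 h2
  rcases le_total 1 R with h3 | h3
  · have h4 : R⁻¹ ≤ 1 := inv_le_one_of_one_le₀ h3
    rw [abs_of_nonneg (by linarith), abs_of_nonpos (by linarith)]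
    linarith
  · have h4 : 1 ≤ R⁻¹ := (one_le_inv₀ hR).2 h3
    rw [abs_of_nonpos (by linarith), abs_of_nonneg (by linarith)]
    linarith

theorem differentiableAt_joukowski (lo hi : ℝ) {z : ℂ} (hz : z ≠ 0) :
    DifferentiableAt ℂ (joukowski lo hi) z := by
  unfold joukowski
  fun_prop (disch := assumption)

/-- The Laurent coefficients of `g ∘ joukowski`. -/
def laurentCoeff (lo hi : ℝ) (g : ℂ → ℂ) (k : ℤ) (R : ℝ) : ℂ :=
  (2 * Real.pi * Complex.I : ℂ)⁻¹ •
    ∮ z in C(0, R), (z - 0)⁻¹ • (z ^ (-k) * g (joukowski lo hi z))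

variable {g : ℂ → ℂ} {M : ℝ}

theorem laurentCoeff_eq (h : lo < hi) (hτ : 0 < τ)
    (hg : ∀ z ∈ openStrip lo hi τ, DifferentiableAt ℂ g z) (k : ℤ) {r R : ℝ}
    (h1 : (ellipseParam lo hi τ)⁻¹ < r) (h2 : r ≤ R) (h3 : R < ellipseParam lo hi τ) :
    laurentCoeff lo hi g k R = laurentCoeff lo hi g k r := by
  have hρ := one_lt_ellipseParam h hτ
  have hr : 0 < r := (inv_pos.2 (by linarith)).trans h1
  have key : ∀ z ∈ Metric.closedBall (0 : ℂ) R \ Metric.ball 0 r,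
      DifferentiableAt ℂ (fun z => z ^ (-k) * g (joukowski lo hi z)) z := by
    rintro z ⟨hz1, hz2⟩
    simp only [Metric.mem_closedBall, dist_zero_right, Metric.mem_ball, not_lt] at hz1 hz2
    have hz : z ≠ 0 := norm_pos_iff.1 (hr.trans_le hz2)
    refine DifferentiableAt.mul (differentiableAt_zpow.2 (Or.inl hz)) ?_
    exact (hg _ (joukowski_mem_openStrip h hτ (by linarith) (by linarith))).comp z
      (differentiableAt_joukowski lo hi hz)
  unfold laurentCoeff
  rw [Complex.circleIntegral_sub_center_inv_smul_eq_of_differentiable_on_annulus_off_countable hr h2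
    Set.countable_empty (fun z hz => (key z hz).continuousAt.continuousWithinAt)]
  rintro z ⟨⟨hz1, hz2⟩, -⟩
  exact key z ⟨Metric.ball_subset_closedBall hz1,
    fun hz3 => hz2 (Metric.ball_subset_closedBall hz3)⟩

theorem norm_laurentCoeff_le (h : lo < hi) (hτ : 0 < τ)
    (hM : ∀ z ∈ openStrip lo hi τ, ‖g z‖ ≤ M) (k : ℤ) {R : ℝ}
    (h1 : (ellipseParam lo hi τ)⁻¹ < R) (h3 : R < ellipseParam lo hi τ) :
    ‖laurentCoeff lo hi g k R‖ ≤ M * R ^ (-k) := by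
  have hρ := one_lt_ellipseParam h hτ
  have hR : 0 < R := (inv_pos.2 (by linarith)).trans h1
  refine (circleIntegral.norm_two_pi_i_inv_smul_integral_le_of_norm_le_const hR.le
    (C := R⁻¹ * (R ^ (-k) * M)) fun z hz => ?_).trans_eq ?_
  · have hz' : ‖z‖ = R := by simpa using hz
    rw [norm_smul, norm_mul, sub_zero, norm_inv, norm_zpow, hz']
    gcongr
    exact hM _ (joukowski_mem_openStrip h hτ (by rwa [hz']) (by rwa [hz']))
  · field_simp

theorem norm_laurentCoeff_one_le (h : lo < hi) (hτ : 0 < τ)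
    (hg : ∀ z ∈ openStrip lo hi τ, DifferentiableAt ℂ g z)
    (hM : ∀ z ∈ openStrip lo hi τ, ‖g z‖ ≤ M) (k : ℤ) :
    ‖laurentCoeff lo hi g k 1‖ ≤ M * (ellipseParam lo hi τ)⁻¹ ^ k.natAbs := by
  have hρ := one_lt_ellipseParam h hτ
  set ρ := ellipseParam lo hi τ with hρdef
  have hinv : ρ⁻¹ < 1 := inv_lt_one_of_one_lt₀ hρ
  have hpos : 0 < ρ⁻¹ := inv_pos.2 (by linarith)
  -- Only the open annulus is available, so circles of radius `s⁻¹` for `k ≥ 0` and `s` for `k ≤ 0`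
  -- are used, and `s` tends to `ρ⁻¹` at the end.
  have key : ∀ s ∈ Set.Ioo ρ⁻¹ 1, ‖laurentCoeff lo hi g k 1‖ ≤ M * s ^ k.natAbs := by
    rintro s ⟨hs1, hs2⟩
    have hs0 : 0 < s := hpos.trans hs1
    rcases le_total 0 k with hk | hk
    · have hs3 : s⁻¹ < ρ := by rwa [inv_lt_comm₀ hs0 (by linarith)]
      have hs4 : 1 < s⁻¹ := (one_lt_inv₀ hs0).2 hs2
      rw [← laurentCoeff_eq h hτ hg k hinv hs4.le hs3]
      refine (norm_laurentCoeff_le h hτ hM k (by linarith) hs3).trans_eq ?_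
      lift k to ℕ using hk
      simp
    · rw [laurentCoeff_eq h hτ hg k hs1 hs2.le (by linarith)]
      refine (norm_laurentCoeff_le h hτ hM k hs1 (by linarith)).trans_eq ?_
      obtain ⟨n, rfl⟩ := Int.exists_eq_neg_ofNat hk
      simp
  have hcont : Filter.Tendsto (fun s : ℝ => M * s ^ k.natAbs) (nhdsWithin ρ⁻¹ (Set.Ioi ρ⁻¹))
      (nhds (M * ρ⁻¹ ^ k.natAbs)) := by
    have : Continuous fun s : ℝ => M * s ^ k.natAbs := by fun_prop
    exact (this.tendsto _).mono_left nhdsWithin_le_nhds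
  refine ge_of_tendsto hcont ?_
  filter_upwards [Ioo_mem_nhdsGT hinv] with s hs using key s hs

instance factTwoPiPos : Fact (0 < 2 * Real.pi) := ⟨Real.two_pi_pos⟩

/-- The function `θ ↦ g (joukowski (e^{iθ}))` on the circle. -/
def circlePullback (lo hi : ℝ) (g : ℂ → ℂ) (x : AddCircle (2 * Real.pi)) : ℂ :=
  g (joukowski lo hi (AddCircle.toCircle x : ℂ))

theorem toCircle_coe (θ : ℝ) : ((AddCircle.toCircle (θ : AddCircle (2 * Real.pi)) : Circle) : ℂ) =
    Complex.exp (θ * Complex.I) := by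
  rw [AddCircle.toCircle_apply_mk, Circle.coe_exp]
  congr 2
  have := Real.pi_ne_zero
  norm_cast
  field_simp

theorem circlePullback_coe (lo hi : ℝ) (g : ℂ → ℂ) (θ : ℝ) :
    circlePullback lo hi g (θ : AddCircle (2 * Real.pi)) =
      g (((lo + hi) / 2 + (hi - lo) / 2 * Real.cos θ : ℝ) : ℂ) := by
  rw [circlePullback, toCircle_coe, joukowski_exp]

theorem fourier_two_pi_coe (k : ℤ) (θ : ℝ) :
    (fourier k (θ : AddCircle (2 * Real.pi)) : ℂ) = Complex.exp (k * (θ * Complex.I)) := by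
  rw [fourier_coe_apply]
  congr 1
  have := Real.pi_ne_zero
  push_cast
  field_simp

theorem fourierCoeff_circlePullback (lo hi : ℝ) (g : ℂ → ℂ) (k : ℤ) :
    fourierCoeff (circlePullback lo hi g) k = laurentCoeff lo hi g k 1 := by
  rw [fourierCoeff_eq_intervalIntegral _ _ 0, laurentCoeff, circleIntegral, zero_add]
  have : ∀ θ : ℝ, deriv (circleMap 0 1) θ • (circleMap 0 1 θ - 0)⁻¹ •
      (circleMap 0 1 θ ^ (-k) * g (joukowski lo hi (circleMap 0 1 θ))) =
      Complex.I * (fourier (-k) (θ : AddCircle (2 * Real.pi)) •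
        circlePullback lo hi g (θ : AddCircle (2 * Real.pi))) := by
    intro θ
    have hc : circleMap 0 1 θ = Complex.exp (θ * Complex.I) := by simp [circleMap]
    rw [deriv_circleMap, fourier_two_pi_coe, circlePullback, toCircle_coe, hc, sub_zero,
      Complex.exp_int_mul, ← smul_assoc, smul_eq_mul, smul_eq_mul, smul_eq_mul]
    linear_combination (Complex.I * (Complex.exp (θ * Complex.I) ^ (-k) *
      g (joukowski lo hi (Complex.exp (θ * Complex.I))))) *
      mul_inv_cancel₀ (Complex.exp_ne_zero (θ * Complex.I))
  simp only [this]
  rw [intervalIntegral.integral_const_mul, smul_eq_mul, Complex.real_smul]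
  have := Real.pi_ne_zero
  have := Complex.I_ne_zero
  push_cast
  field_simp

theorem continuous_circlePullback (h : lo < hi) (hτ : 0 < τ)
    (hg : ∀ z ∈ openStrip lo hi τ, DifferentiableAt ℂ g z) :
    Continuous (circlePullback lo hi g) := by
  have hρ := one_lt_ellipseParam h hτ
  refine continuous_iff_continuousAt.2 fun x => ?_
  have hn : ‖((AddCircle.toCircle x : Circle) : ℂ)‖ = 1 := Circle.norm_coe _
  have hmem := joukowski_mem_openStrip h hτ (z := ((AddCircle.toCircle x : Circle) : ℂ))
    (by rw [hn]; exact inv_lt_one_of_one_lt₀ hρ) (by rwa [hn])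
  have h1 : Continuous fun x : AddCircle (2 * Real.pi) => ((AddCircle.toCircle x : Circle) : ℂ) :=
    continuous_subtype_val.comp AddCircle.continuous_toCircle
  have h2 : ContinuousAt (joukowski lo hi) ((AddCircle.toCircle x : Circle) : ℂ) :=
    (differentiableAt_joukowski lo hi (Circle.coe_ne_zero _)).continuousAt
  exact ContinuousAt.comp (f := fun x : AddCircle (2 * Real.pi) =>
      joukowski lo hi ((AddCircle.toCircle x : Circle) : ℂ)) (hg _ hmem).continuousAt
    (ContinuousAt.comp (f := fun x : AddCircle (2 * Real.pi) =>
      ((AddCircle.toCircle x : Circle) : ℂ)) h2 h1.continuousAt)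

theorem summable_pow_natAbs {r : ℝ} (h0 : 0 ≤ r) (h1 : r < 1) :
    Summable fun k : ℤ => r ^ k.natAbs := by
  refine Summable.of_nat_of_neg ?_ ?_ <;> simpa using summable_geometric_of_lt_one h0 h1

/-- A bounded holomorphic function near an interval has a Chebyshev series with geometrically
decaying coefficients. -/
theorem exists_hasSum_chebyshevOn (h : lo < hi) (hτ : 0 < τ)
    (hg : ∀ z ∈ openStrip lo hi τ, DifferentiableAt ℂ g z)
    (hM : ∀ z ∈ openStrip lo hi τ, ‖g z‖ ≤ M) :
    ∃ c : ℤ → ℂ, (∀ k, ‖c k‖ ≤ M * (ellipseParam lo hi τ)⁻¹ ^ k.natAbs) ∧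
      ∀ t ∈ Set.Icc lo hi,
        HasSum (fun k => c k * (((chebyshevOn lo hi k).eval t : ℝ) : ℂ)) (g t) := by
  have hρ := one_lt_ellipseParam h hτ
  have hbound := norm_laurentCoeff_one_le h hτ hg hM
  refine ⟨fun k => laurentCoeff lo hi g k 1, hbound, fun t ht => ?_⟩
  have hsum : Summable fun k => laurentCoeff lo hi g k 1 :=
    Summable.of_norm_bounded ((summable_pow_natAbs (inv_nonneg.2 (by linarith))
      (inv_lt_one_of_one_lt₀ hρ)).mul_left M) hbound
  obtain ⟨θ, rfl⟩ := exists_cos_eq_of_mem_Icc h ht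
  let f : C(AddCircle (2 * Real.pi), ℂ) := ⟨_, continuous_circlePullback h hτ hg⟩
  have hf : fourierCoeff f = fun k => laurentCoeff lo hi g k 1 :=
    funext fun k => fourierCoeff_circlePullback lo hi g k
  have hs : Summable (fourierCoeff f) := by rwa [hf]
  have key : ∀ θ' : ℝ, Real.cos θ' = Real.cos θ →
      HasSum (fun k : ℤ => laurentCoeff lo hi g k 1 * Complex.exp (k * (θ' * Complex.I)))
        (g (((lo + hi) / 2 + (hi - lo) / 2 * Real.cos θ : ℝ) : ℂ)) := by
    intro θ' hθ'
    have := has_pointwise_sum_fourier_series_of_summable hs (θ' : AddCircle (2 * Real.pi))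
    rw [hf] at this
    simp only [fourier_two_pi_coe, smul_eq_mul] at this
    rwa [show f (θ' : AddCircle (2 * Real.pi)) = _ from circlePullback_coe lo hi g θ', hθ'] at this
  -- The angles `θ` and `-θ` give the same point of the interval; averaging the two Fourier series
  -- turns `e^{ikθ}` into `cos kθ`, the value of `T_k`.
  have hadd := ((key θ rfl).add (key (-θ) (Real.cos_neg θ))).mul_left (2⁻¹ : ℂ)
  convert! hadd using 1
  · ext k
    rw [chebyshevOn_eval_cos h, Complex.ofReal_cos, Complex.cos]
    push_cast
    ring_nf
  · ring

end ChebyshevSeries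

/-! ### Tensor products of kernels acting on holomorphic functions -/

section Holomorphic

theorem tsum_natAbs_tail_le {r : ℝ} (h0 : 0 ≤ r) (h1 : r < 1) (s : ℕ) :
    Summable (fun k : ℤ => if s ≤ k.natAbs then r ^ k.natAbs else 0) ∧
      ∑' k : ℤ, (if s ≤ k.natAbs then r ^ k.natAbs else 0) ≤ 2 / (1 - r) * r ^ s := by
  have hnat : HasSum (fun n : ℕ => r ^ (n + s)) (r ^ s / (1 - r)) := by
    simpa [pow_add, mul_comm, div_eq_mul_inv] using
      (hasSum_geometric_of_lt_one h0 h1).mul_left (r ^ s)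
  have hnat' : HasSum (fun n : ℕ => if s ≤ n then r ^ n else 0) (r ^ s / (1 - r)) := by
    rw [← hasSum_nat_add_iff' s]
    have : ∑ i ∈ Finset.range s, (if s ≤ i then r ^ i else 0) = 0 :=
      Finset.sum_eq_zero fun i hi => if_neg (by simpa using hi)
    simpa [this] using hnat
  have hneg : HasSum (fun n : ℕ => if s ≤ n + 1 then r ^ (n + 1) else 0)
      (r ^ s / (1 - r) - if s ≤ 0 then r ^ 0 else 0) := by
    have := (hasSum_nat_add_iff' 1).2 hnat'
    simpa using this
  have hint := HasSum.of_nat_of_neg_add_one (f := fun k : ℤ =>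
    if s ≤ k.natAbs then r ^ k.natAbs else 0) (by simpa using hnat')
    (by
      convert hneg using 2 with n
      have : (-((n : ℤ) + 1)).natAbs = n + 1 := by omega
      rw [this])
  refine ⟨hint.summable, ?_⟩
  rw [hint.tsum_eq]
  have : (0 : ℝ) ≤ if s ≤ 0 then r ^ 0 else 0 := by split_ifs <;> simp
  rw [div_mul_eq_mul_div, mul_div_assoc]
  linarith

variable {lo hi τ : ℝ}

/-- A kernel that is bounded on Chebyshev polynomials and annihilates those of low degree is
small on holomorphic functions. -/
theorem PointKernel.norm_act_le (h : lo < hi) (hτ : 0 < τ) {K : PointKernel} {t : ℝ}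
    (hK : ∀ x ∈ (K (Finsupp.single t 1)).support, x ∈ Set.Icc lo hi) {B : ℝ} {s : ℕ}
    (hB : ∀ k : ℤ, |K.act (fun x => (chebyshevOn lo hi k).eval x) t| ≤ B)
    (hs : ∀ k : ℤ, k.natAbs < s → K.act (fun x => (chebyshevOn lo hi k).eval x) t = 0)
    {g : ℂ → ℂ} {M : ℝ} (hg : ∀ z ∈ openStrip lo hi τ, DifferentiableAt ℂ g z)
    (hM : ∀ z ∈ openStrip lo hi τ, ‖g z‖ ≤ M) :
    ‖K.act (fun x : ℝ => g x) t‖ ≤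
      B * (2 / (1 - (ellipseParam lo hi τ)⁻¹)) * (ellipseParam lo hi τ)⁻¹ ^ s * M := by
  have hρ := one_lt_ellipseParam h hτ
  set r := (ellipseParam lo hi τ)⁻¹ with hr
  have hr0 : 0 ≤ r := inv_nonneg.2 (by linarith)
  have hr1 : r < 1 := inv_lt_one_of_one_lt₀ hρ
  obtain ⟨c, hc, hsum⟩ := exists_hasSum_chebyshevOn h hτ hg hM
  have hM0 : 0 ≤ M := by simpa using (norm_nonneg _).trans (hc 0)
  have hB0 : 0 ≤ B := (abs_nonneg _).trans (hB 0)
  -- The kernel is a finite combination of values in the interval, so it acts on the Chebyshev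
  -- series term by term.
  have hact : HasSum (fun k => c k * ((K.act (fun x => (chebyshevOn lo hi k).eval x) t : ℝ) : ℂ))
      (K.act (fun x : ℝ => g x) t) := by
    simp only [PointKernel.act_eq_sum]
    convert! hasSum_sum fun x hx => (hsum x (hK x hx)).const_smul ((K (Finsupp.single t 1)) x)
      using 1
    ext k
    push_cast
    rw [Finset.mul_sum]
    refine Finset.sum_congr rfl fun x _ => ?_
    simp only [smul_eq_mul, Complex.real_smul]
    push_cast
    ring
  obtain ⟨h1, h2⟩ := tsum_natAbs_tail_le hr0 hr1 s
  have hle := hact.norm_le_of_bounded ((h1.hasSum).mul_left (M * B)) fun k => by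
    rw [norm_mul, Complex.norm_real, Real.norm_eq_abs]
    split_ifs with hk
    · calc ‖c k‖ * _ ≤ (M * r ^ k.natAbs) * B :=
          mul_le_mul (hc k) (hB k) (abs_nonneg _) (by positivity)
        _ = _ := by ring
    · rw [hs k (not_le.1 hk)]
      simp
  calc _ ≤ _ := hle
    _ ≤ M * B * (2 / (1 - r) * r ^ s) := by gcongr
    _ = _ := by ring

/-- `K` maps the unit ball of the bounded holomorphic functions on the strip to functions that
are at most `ε` on the interval, and only uses values on the interval. -/
structure PointKernel.BoundOn (lo hi τ : ℝ) (K : PointKernel) (ε : ℝ) : Prop where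
  support : ∀ t ∈ Set.Icc lo hi, ∀ x ∈ (K (Finsupp.single t 1)).support, x ∈ Set.Icc lo hi
  bound : ∀ (g : ℂ → ℂ) (M : ℝ), (∀ z ∈ openStrip lo hi τ, DifferentiableAt ℂ g z) →
    (∀ z ∈ openStrip lo hi τ, ‖g z‖ ≤ M) → ∀ t ∈ Set.Icc lo hi,
      ‖K.act (fun x : ℝ => g x) t‖ ≤ ε * M

theorem ofReal_mem_openStrip (hτ : 0 < τ) {t : ℝ} (ht : t ∈ Set.Icc lo hi) :
    (t : ℂ) ∈ openStrip lo hi τ := by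
  have : Metric.infDist (t : ℂ) ((fun t : ℝ => (t : ℂ)) '' Set.Icc lo hi) = 0 :=
    Metric.infDist_zero_of_mem ⟨t, ht, rfl⟩
  simpa [openStrip, this] using hτ

end Holomorphic

/-! ### Several variables: applying one kernel at a time. -/

section Multivariate

variable {N : ℕ} {lo hi τ : Fin N → ℝ}

/-- The points of the polystrip whose coordinates outside `S` are real. -/
def partialStrip (lo hi τ : Fin N → ℝ) (S : Set (Fin N)) : Set (Fin N → ℂ) :=
  {z | (∀ n, z n ∈ openStrip (lo n) (hi n) (τ n)) ∧
    ∀ n ∉ S, ∃ t ∈ Set.Icc (lo n) (hi n), z n = (t : ℂ)}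

theorem update_mem_partialStrip {S : Set (Fin N)} {z : Fin N → ℂ} {n : Fin N} (hn : n ∈ S)
    (hz : z ∈ partialStrip lo hi τ (S \ {n})) {w : ℂ}
    (hw : w ∈ openStrip (lo n) (hi n) (τ n)) :
    Function.update z n w ∈ partialStrip lo hi τ S := by
  refine ⟨fun l => ?_, fun l hl => ?_⟩
  · by_cases h : l = n
    · subst h; simpa using hw
    · simpa [Function.update_of_ne h] using hz.1 l
  · have h : l ≠ n := fun h => hl (h ▸ hn)
    simpa [Function.update_of_ne h] using hz.2 l (fun h' => hl h'.1)

/-- `v` extends to a function on the polystrip that is bounded by `M` and holomorphic in each of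
the variables in `S`, the other variables being real. -/
def HolomorphicIn (lo hi τ : Fin N → ℝ) (S : Set (Fin N)) (M : ℝ) (v : (Fin N → ℝ) → ℂ) :
    Prop :=
  ∃ H : (Fin N → ℂ) → ℂ, (∀ y ∈ paramBox lo hi, H (fun n => (y n : ℂ)) = v y) ∧
    ∀ z ∈ partialStrip lo hi τ S, ‖H z‖ ≤ M ∧
      ∀ n ∈ S, DifferentiableAt ℂ (fun t => H (Function.update z n t)) (z n)

theorem HolomorphicIn.lift (hτ : ∀ n, 0 < τ n) {S : Set (Fin N)} {M : ℝ}
    {v : (Fin N → ℝ) → ℂ} (hv : HolomorphicIn lo hi τ S M v) {n : Fin N} (hn : n ∈ S)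
    {K : PointKernel} {ε : ℝ} (hK : K.BoundOn (lo n) (hi n) (τ n) ε) :
    HolomorphicIn lo hi τ (S \ {n}) (ε * M) (lift n K v) := by
  obtain ⟨H, hH1, hH2⟩ := hv
  -- On the smaller partial strip the `n`-th coordinate is real, so passing to its real part changes
  -- nothing; only holomorphy in that variable is given up.
  refine ⟨fun z => K.act (fun x : ℝ => H (Function.update z n (x : ℂ))) (z n).re, ?_, ?_⟩
  · intro y hy
    simp only [lift_apply, Complex.ofReal_re]
    rw [PointKernel.act_eq_sum, PointKernel.act_eq_sum]
    refine Finset.sum_congr rfl fun x hx => ?_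
    have hx' := hK.support _ (hy n) x hx
    rw [← hH1]
    · congr 2
      ext l
      by_cases h : l = n
      · subst h; simp
      · simp [Function.update_of_ne h]
    · intro l
      by_cases h : l = n
      · subst h; simpa using hx'
      · simpa [Function.update_of_ne h] using hy l
  · intro z hz
    obtain ⟨t, ht, hzt⟩ := hz.2 n (fun h => h.2 rfl)
    have hre : (z n).re = t := by rw [hzt, Complex.ofReal_re]
    refine ⟨?_, fun l hl => ?_⟩
    · simp only [hre]
      refine hK.bound (fun w => H (Function.update z n w)) M (fun w hw => ?_) (fun w hw => ?_) t ht
      · have := (hH2 _ (update_mem_partialStrip hn hz hw)).2 n hn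
        simpa using this
      · exact (hH2 _ (update_mem_partialStrip hn hz hw)).1
    · have hln : l ≠ n := fun h => hl.2 h
      simp only [Function.update_of_ne hln.symm, hre, PointKernel.act_eq_sum]
      refine DifferentiableAt.fun_sum fun x hx => DifferentiableAt.const_smul ?_ _
      have hx' := ofReal_mem_openStrip (hτ n) (hK.support t ht x hx)
      have := (hH2 _ (update_mem_partialStrip hn hz hx')).2 l hl.1
      rw [Function.update_of_ne hln] at this
      simp only [Function.update_comm hln]
      exact this

theorem HolomorphicIn.listOp (hτ : ∀ n, 0 < τ n) {M : ℝ} {v : (Fin N → ℝ) → ℂ}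
    (hv : HolomorphicIn lo hi τ Set.univ M v) {K : Fin N → PointKernel} {ε : Fin N → ℝ}
    (hK : ∀ n, (K n).BoundOn (lo n) (hi n) (τ n) (ε n)) {L : List (Fin N)} (hL : L.Nodup) :
    HolomorphicIn lo hi τ {n | n ∉ L} ((L.map ε).prod * M) (listOp L K v) := by
  induction L with
  | nil => simpa [listOp_nil] using hv
  | cons n L ih =>
    obtain ⟨h1, h2⟩ := List.nodup_cons.1 hL
    have := (ih h2).lift hτ (n := n) h1 (hK n)
    rw [listOp_cons, List.map_cons, List.prod_cons, mul_assoc]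
    rw [Module.End.mul_apply]
    convert this using 1
    ext l
    simp [and_comm]

/-- The tensor product bound for functions that are holomorphic in each variable. -/
theorem HolomorphicIn.norm_tensorOp_le (hτ : ∀ n, 0 < τ n) {M : ℝ} {v : (Fin N → ℝ) → ℂ}
    (hv : HolomorphicIn lo hi τ Set.univ M v) {K : Fin N → PointKernel} {ε : Fin N → ℝ}
    (hK : ∀ n, (K n).BoundOn (lo n) (hi n) (τ n) (ε n)) {y : Fin N → ℝ}
    (hy : y ∈ paramBox lo hi) : ‖tensorOp K v y‖ ≤ (∏ n, ε n) * M := by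
  obtain ⟨H, hH1, hH2⟩ := hv.listOp hτ hK (List.nodup_finRange N)
  rw [tensorOp, ← hH1 y hy]
  refine ((hH2 _ ⟨fun n => ofReal_mem_openStrip (hτ n) (hy n),
    fun n _ => ⟨y n, hy n, rfl⟩⟩).1).trans_eq ?_
  rw [← List.ofFn_eq_map, List.prod_ofFn]

end Multivariate

/-! ### The Lebesgue constants of the Clenshaw–Curtis nodes -/

section Lebesgue

open Polynomial

/-- Twice the modified Dirichlet kernel. -/
def dirichletSum (n : ℕ) (s : ℝ) : ℝ :=
  ∑ k ∈ Finset.range n, (Real.cos (k * s) + Real.cos ((k + 1 : ℕ) * s))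

/-- Telescoping: `sin(s/2) (cos ks + cos (k+1)s) = cos(s/2) (sin (k+1)s - sin ks)`. -/
theorem sin_mul_dirichletSum (n : ℕ) (s : ℝ) :
    Real.sin (s / 2) * dirichletSum n s = Real.cos (s / 2) * Real.sin (n * s) := by
  unfold dirichletSum
  induction n with
  | zero => simp
  | succ n ih =>
    rw [Finset.sum_range_succ, mul_add, ih]
    have e1 : (n : ℝ) * s = (n * s + s / 2) - s / 2 := by ring
    have e2 : ((n + 1 : ℕ) : ℝ) * s = (n * s + s / 2) + s / 2 := by push_cast; ring
    rw [e1, e2]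
    generalize n * s + s / 2 = x
    rw [Real.cos_add, Real.cos_sub, Real.sin_add, Real.sin_sub]
    ring

theorem abs_dirichletSum_le (n : ℕ) (s : ℝ) : |dirichletSum n s| ≤ 2 * n := by
  refine (Finset.abs_sum_le_sum_abs _ _).trans ?_
  refine (Finset.sum_le_card_nsmul _ _ 2 fun k _ => ?_).trans_eq (by simp [mul_comm])
  refine (abs_add_le _ _).trans ?_
  linarith [Real.abs_cos_le_one (k * s), Real.abs_cos_le_one ((k + 1 : ℕ) * s)]

theorem dirichletSum_neg (n : ℕ) (s : ℝ) : dirichletSum n (-s) = dirichletSum n s := by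
  simp [dirichletSum]

/-- Jordan's inequality gives `sin(s/2) ≥ d/n`, hence the bound `n/d ≤ 2n/(d+1)`; for `d = 0` the
trivial bound `2n` is used. -/
theorem abs_dirichletSum_le_div {n : ℕ} (hn : 0 < n) (d : ℕ) {s : ℝ}
    (h1 : d * Real.pi / n ≤ s) (h2 : s ≤ 2 * Real.pi - d * Real.pi / n) :
    |dirichletSum n s| ≤ 2 * n / (d + 1) := by
  rcases Nat.eq_zero_or_pos d with rfl | hd
  · simpa using abs_dirichletSum_le n s
  have hπ := Real.pi_pos
  have hn' : (0 : ℝ) < n := by exact_mod_cast hn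
  have hd' : (1 : ℝ) ≤ d := by exact_mod_cast hd
  have hpos : 0 ≤ d * Real.pi / n := by positivity
  have hsin : (d : ℝ) / n ≤ Real.sin (s / 2) := by
    have key : ∀ x, x ≤ Real.pi / 2 → d * Real.pi / n / 2 ≤ x → (d : ℝ) / n ≤ Real.sin x := by
      intro x hx1 hx2
      have := Real.mul_le_sin (by linarith) hx1
      refine le_trans ?_ this
      calc (d : ℝ) / n = 2 / Real.pi * (d * Real.pi / n / 2) := by field_simp
        _ ≤ _ := by gcongr
    rcases le_total (s / 2) (Real.pi / 2) with h | h
    · exact key _ h (by linarith)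
    · rw [← Real.sin_pi_sub]
      exact key _ (by linarith) (by linarith)
  have hprod : |Real.sin (s / 2) * dirichletSum n s| ≤ 1 := by
    rw [sin_mul_dirichletSum, abs_mul]
    exact mul_le_one₀ (Real.abs_cos_le_one _) (abs_nonneg _) (Real.abs_sin_le_one _)
  have hq : 0 < (d : ℝ) / n := by positivity
  rw [abs_mul, abs_of_pos (hq.trans_le hsin)] at hprod
  have h3 : (d : ℝ) / n * |dirichletSum n s| ≤ 1 :=
    (mul_le_mul_of_nonneg_right hsin (abs_nonneg _)).trans hprod
  rw [div_mul_eq_mul_div, div_le_one hn'] at h3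
  rw [le_div_iff₀ (by positivity)]
  nlinarith [abs_nonneg (dirichletSum n s)]

theorem dirichletSum_eq_zero {n : ℕ} (hn : 0 < n) {l : ℤ} (h1 : 0 < l) (h2 : l < 2 * n) :
    dirichletSum n (l * Real.pi / n) = 0 := by
  have hn' : (0 : ℝ) < n := by exact_mod_cast hn
  have hπ := Real.pi_pos
  have h1' : (0 : ℝ) < l := by exact_mod_cast h1
  have h2' : (l : ℝ) < 2 * n := by exact_mod_cast h2
  have h := sin_mul_dirichletSum n (l * Real.pi / n)
  rw [mul_div_cancel₀ _ hn'.ne', Real.sin_int_mul_pi, mul_zero] at h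
  refine (mul_eq_zero.1 h).resolve_left (Real.sin_pos_of_pos_of_lt_pi (by positivity) ?_).ne'
  rw [div_div, div_lt_iff₀ (by positivity)]
  nlinarith

theorem dirichletSum_zero (n : ℕ) : dirichletSum n 0 = 2 * n := by
  norm_num [dirichletSum, mul_comm]

theorem dirichletSum_nonneg_at_nodes {n : ℕ} (hn : 0 < n) {l : ℤ} (h1 : 0 ≤ l)
    (h2 : l ≤ 2 * n) : 0 ≤ dirichletSum n (l * Real.pi / n) := by
  have hn' : (0 : ℝ) < n := by exact_mod_cast hn
  rcases h1.eq_or_lt with rfl | h1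
  · simp [dirichletSum_zero]
  rcases h2.eq_or_lt with rfl | h2
  · refine Finset.sum_nonneg fun k _ => ?_
    have : ∀ k : ℕ, Real.cos (k * (((2 * n : ℤ) : ℝ) * Real.pi / n)) = 1 := by
      intro k
      rw [← Real.cos_nat_mul_two_pi k]
      congr 1
      push_cast
      field_simp
    rw [this, this]
    norm_num
  · exact (dirichletSum_eq_zero hn h1 h2).ge

/-- A multiple of the Lagrange basis polynomial at the Chebyshev–Lobatto node
`cos (i π / n)`. -/
def lobattoPoly (lo hi : ℝ) (n i : ℕ) : ℝ[X] :=
  ∑ k ∈ Finset.range n, (C (Real.cos (k * (i * Real.pi / n))) * chebyshevOn lo hi k +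
    C (Real.cos ((k + 1 : ℕ) * (i * Real.pi / n))) * chebyshevOn lo hi (k + 1 : ℕ))

variable {lo hi : ℝ}

theorem degree_lobattoPoly_lt (lo hi : ℝ) (n i : ℕ) :
    (lobattoPoly lo hi n i).degree < ((n + 1 : ℕ) : WithBot ℕ) := by
  rw [← Polynomial.mem_degreeLT]
  refine Submodule.sum_mem _ fun k hk => Submodule.add_mem _ ?_ ?_ <;>
  · rw [← smul_eq_C_mul]
    refine Submodule.smul_mem _ _ ?_
    rw [Polynomial.mem_degreeLT]
    have := Finset.mem_range.1 hk
    exact degree_chebyshevOn_lt lo hi (by omega)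

theorem lobattoPoly_eval_cos (h : lo < hi) (n i : ℕ) (θ : ℝ) :
    (lobattoPoly lo hi n i).eval ((lo + hi) / 2 + (hi - lo) / 2 * Real.cos θ) =
      (dirichletSum n (θ - i * Real.pi / n) + dirichletSum n (θ + i * Real.pi / n)) / 2 := by
  simp only [lobattoPoly, eval_finsetSum, eval_add, eval_mul, eval_C, chebyshevOn_eval_cos h,
    dirichletSum]
  rw [← Finset.sum_add_distrib, Finset.sum_div]
  refine Finset.sum_congr rfl fun k _ => ?_
  simp only [mul_add, mul_sub, Real.cos_add, Real.cos_sub]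
  push_cast
  ring

/-- In the angle the polynomial is the mean of two kernels. With `x = iπ/n`, the point `θ + x` is at
distance at least `|θ - x|` from both `0` and `2π`, so both kernels obey the same bound. -/
theorem abs_lobattoPoly_eval_le (h : lo < hi) {n i : ℕ} (hn : 0 < n) (hi' : i ≤ n) {θ : ℝ}
    (h0 : 0 ≤ θ) (hπ : θ ≤ Real.pi) {d : ℕ} (hd : d * Real.pi / n ≤ |θ - i * Real.pi / n|) :
    |(lobattoPoly lo hi n i).eval ((lo + hi) / 2 + (hi - lo) / 2 * Real.cos θ)| ≤
      2 * n / (d + 1) := by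
  have hn' : (0 : ℝ) < n := by exact_mod_cast hn
  have hpi := Real.pi_pos
  set x := i * Real.pi / n with hx
  have hx0 : 0 ≤ x := by positivity
  have hx1 : x ≤ Real.pi := by
    rw [hx, div_le_iff₀ hn', mul_comm]
    gcongr
  rw [lobattoPoly_eval_cos h, abs_div, abs_two, div_le_iff₀ two_pos]
  refine (abs_add_le _ _).trans ?_
  have e1 : |dirichletSum n (θ - x)| ≤ 2 * n / (d + 1) := by
    have : dirichletSum n (θ - x) = dirichletSum n |θ - x| := by
      rcases abs_choice (θ - x) with h | h <;> rw [h]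
      rw [dirichletSum_neg]
    rw [this]
    refine abs_dirichletSum_le_div hn d hd (?_)
    have : |θ - x| ≤ Real.pi := abs_le.2 ⟨by linarith, by linarith⟩
    linarith
  have e2 : |dirichletSum n (θ + x)| ≤ 2 * n / (d + 1) := by
    refine abs_dirichletSum_le_div hn d ?_ ?_ <;>
      rcases abs_cases (θ - x) with ⟨h, _⟩ | ⟨h, _⟩ <;> linarith
  linarith

/-- The polynomial vanishes at all other nodes and is at least `n` at its own, so it is the basis
polynomial times a factor of at least `n`. The index is `n - j` because the nodes are numbered from
`lo`, where the angle is `π`. -/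
theorem abs_basis_ccNode_le (h : lo < hi) {n : ℕ} (hn : 0 < n) (j : Fin (n + 1)) (t : ℝ) :
    |(Lagrange.basis Finset.univ (ccNode lo hi (n + 1)) j).eval t| ≤
      |(lobattoPoly lo hi n (n - j)).eval t| / n := by
  have hn' : (0 : ℝ) < n := by exact_mod_cast hn
  have hnode : ∀ j' : Fin (n + 1), ccNode lo hi (n + 1) j' =
      (lo + hi) / 2 + (hi - lo) / 2 * Real.cos (((n - j' : ℕ) : ℝ) * Real.pi / n) := by
    intro j'
    rw [ccNode_eq_cos (by omega), Nat.add_sub_cancel]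
  have hsub : ∀ p q : ℕ, (p : ℝ) * Real.pi / n - q * Real.pi / n =
      ((p - q : ℤ) : ℝ) * Real.pi / n := by
    intro p q; push_cast; ring
  have hadd : ∀ p q : ℕ, (p : ℝ) * Real.pi / n + q * Real.pi / n =
      ((p + q : ℤ) : ℝ) * Real.pi / n := by
    intro p q; push_cast; ring
  have hoff : ∀ j' : Fin (n + 1), j' ≠ j →
      (lobattoPoly lo hi n (n - j)).eval (ccNode lo hi (n + 1) j') = 0 := by
    intro j' hj'
    have h1 := j.2
    have h2 := j'.2
    have hne : (j' : ℕ) ≠ j := fun h' => hj' (Fin.ext h')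
    have e1 := dirichletSum_eq_zero hn (l := ((n - j' : ℕ) + (n - j : ℕ) : ℤ)) (by omega) (by omega)
    rw [hnode, lobattoPoly_eval_cos h, hsub, hadd, e1]
    rcases lt_or_gt_of_ne hne with h3 | h3
    · have e2 := dirichletSum_eq_zero hn (l := ((n - j' : ℕ) - (n - j : ℕ) : ℤ)) (by omega)
        (by omega)
      rw [e2]
      simp
    · have e2 := dirichletSum_eq_zero hn (l := -((n - j' : ℕ) - (n - j : ℕ) : ℤ)) (by omega)
        (by omega)
      rw [← dirichletSum_neg, ← neg_div, ← neg_mul, ← Int.cast_neg, e2]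
      simp
  have hon : (n : ℝ) ≤ (lobattoPoly lo hi n (n - j)).eval (ccNode lo hi (n + 1) j) := by
    rw [hnode, lobattoPoly_eval_cos h, hadd, sub_self, dirichletSum_zero]
    have := dirichletSum_nonneg_at_nodes hn (l := ((n - j : ℕ) + (n - j : ℕ) : ℤ)) (by omega)
      (by omega)
    linarith
  have hsum := sum_basis_eval_mul h (degree_lobattoPoly_lt lo hi n (n - j)) t
  rw [Finset.sum_eq_single j (fun j' _ hj' => by rw [hoff j' hj', mul_zero]) (by simp)] at hsum
  rw [le_div_iff₀ hn', ← hsum, abs_mul]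
  exact mul_le_mul_of_nonneg_left (hon.trans (le_abs_self _)) (abs_nonneg _)

/-- If the angle of `t` lies between the grid angles number `p` and `p + 1`, the grid angle number
`i` is at least `d i` steps away, and its basis polynomial is at most `2/(d i + 1)`. Each value of
`d` occurs at most twice, which leaves two harmonic sums. -/
theorem sum_basis_ccNode_le_harmonic (h : lo < hi) {n : ℕ} (hn : 0 < n) {t : ℝ}
    (ht : t ∈ Set.Icc lo hi) :
    ∑ j : Fin (n + 1), |(Lagrange.basis Finset.univ (ccNode lo hi (n + 1)) j).eval t| ≤
      4 * (harmonic (n + 1) : ℝ) := by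
  have hn' : (0 : ℝ) < n := by exact_mod_cast hn
  have hπ := Real.pi_pos
  obtain ⟨θ₀, hθ₀⟩ := exists_cos_eq_of_mem_Icc h ht
  set θ := Real.arccos (Real.cos θ₀) with hθ
  have hcos : Real.cos θ = Real.cos θ₀ :=
    Real.cos_arccos (Real.neg_one_le_cos _) (Real.cos_le_one _)
  rw [← hcos] at hθ₀
  have h0 : 0 ≤ θ := Real.arccos_nonneg _
  have h1 : θ ≤ Real.pi := Real.arccos_le_pi _
  set p := ⌊θ * n / Real.pi⌋₊ with hp
  have hp1 : p * Real.pi / n ≤ θ := by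
    have := Nat.floor_le (a := θ * n / Real.pi) (by positivity)
    rw [le_div_iff₀ hπ] at this
    rwa [div_le_iff₀ hn']
  have hp2 : θ ≤ (p + 1) * Real.pi / n := by
    have := (Nat.lt_floor_add_one (θ * n / Real.pi)).le
    rw [div_le_iff₀ hπ] at this
    rwa [le_div_iff₀ hn']
  let d : ℕ → ℕ := fun i => if i ≤ p then p - i else i - p - 1
  have hd : ∀ i : ℕ, d i * Real.pi / n ≤ |θ - i * Real.pi / n| := by
    intro i
    by_cases hi : i ≤ p
    · simp only [d, if_pos hi]
      rw [Nat.cast_sub hi]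
      refine le_trans ?_ (le_abs_self _)
      rw [sub_mul, sub_div]
      linarith
    · simp only [d, if_neg hi]
      rw [Nat.sub_sub, Nat.cast_sub (by omega)]
      refine le_trans ?_ (neg_le_abs _)
      rw [sub_mul, sub_div]
      push_cast
      linarith
  have hpn : p ≤ n := by
    have : (p : ℝ) ≤ n := by
      rw [div_le_iff₀ hn'] at hp1
      have : (p : ℝ) * Real.pi ≤ n * Real.pi := by nlinarith
      exact le_of_mul_le_mul_right this hπ
    exact_mod_cast this
  have hbound : ∀ j : Fin (n + 1),
      |(Lagrange.basis Finset.univ (ccNode lo hi (n + 1)) j).eval t| ≤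
        2 * ((d (n - j) + 1 : ℕ) : ℝ)⁻¹ := by
    intro j
    refine (abs_basis_ccNode_le h hn j t).trans ?_
    rw [div_le_iff₀ hn', hθ₀]
    refine (abs_lobattoPoly_eval_le h hn (Nat.sub_le _ _) h0 h1 (hd (n - j))).trans_eq ?_
    push_cast
    field_simp
  refine (Finset.sum_le_sum fun j _ => hbound j).trans ?_
  rw [Fin.sum_univ_eq_sum_range (fun j => 2 * ((d (n - j) + 1 : ℕ) : ℝ)⁻¹) (n + 1),
    ← Finset.mul_sum, ← Finset.sum_range_reflect]
  have hharm : ∀ q, q ≤ n + 1 → ∑ i ∈ Finset.range q, ((i + 1 : ℕ) : ℝ)⁻¹ ≤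
      (harmonic (n + 1) : ℝ) := by
    intro q hq
    rw [harmonic]
    push_cast
    exact Finset.sum_le_sum_of_subset_of_nonneg (Finset.range_mono hq) fun i _ _ => by positivity
  have hsplit : ∑ i ∈ Finset.range (n + 1), ((d (n - (n + 1 - 1 - i)) + 1 : ℕ) : ℝ)⁻¹ =
      ∑ i ∈ Finset.range (p + 1), ((i + 1 : ℕ) : ℝ)⁻¹ +
        ∑ i ∈ Finset.range (n - p), ((i + 1 : ℕ) : ℝ)⁻¹ := by
    rw [show n + 1 = (p + 1) + (n - p) by omega, Finset.sum_range_add,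
      ← Finset.sum_range_reflect (fun i => ((i + 1 : ℕ) : ℝ)⁻¹) (p + 1)]
    congr 1
    · refine Finset.sum_congr rfl fun i hi => ?_
      have := Finset.mem_range.1 hi
      have hi' : n - (p + 1 + (n - p) - 1 - i) = i := by omega
      simp only [d, hi', if_pos (show i ≤ p by omega)]
      congr 3
    · refine Finset.sum_congr rfl fun i hi => ?_
      have := Finset.mem_range.1 hi
      have hi' : n - (p + 1 + (n - p) - 1 - (p + 1 + i)) = p + 1 + i := by omega
      simp only [d, hi', if_neg (show ¬ p + 1 + i ≤ p by omega)]
      congr 3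
      omega
  rw [hsplit]
  linarith [hharm (p + 1) (by omega), hharm (n - p) (by omega)]

/-- The Lebesgue constants of the Clenshaw–Curtis nodes grow at most linearly in the level. -/
theorem sum_basis_ccNode_level_le (h : lo < hi) {k : ℕ} (hk : 0 < k) {t : ℝ}
    (ht : t ∈ Set.Icc lo hi) :
    ∑ j : Fin (level k), |(Lagrange.basis Finset.univ (ccNode lo hi (level k)) j).eval t| ≤
      8 * k := by
  match k, hk with
  | 1, _ =>
    have key : ∀ m, m = 1 →
        ∑ j : Fin m, |(Lagrange.basis Finset.univ (ccNode lo hi m) j).eval t| ≤ 8 := by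
      rintro m rfl
      have h1 : (Finset.univ : Finset (Fin 1)) = {0} := rfl
      rw [h1, Finset.sum_singleton, Lagrange.basis_singleton]
      norm_num
    simpa using key (level 1) rfl
  | k + 2, _ =>
    refine (sum_basis_ccNode_le_harmonic h (n := 2 ^ (k + 1)) (by positivity) ht).trans ?_
    have h1 := harmonic_le_one_add_log (2 ^ (k + 1) + 1)
    -- The constant 8 results from `4 (1 + (k + 2)) ≤ 8 (k + 2)`.
    have h2 : Real.log ((2 ^ (k + 1) + 1 : ℕ) : ℝ) ≤ k + 2 := by
      have h3 : ((2 ^ (k + 1) + 1 : ℕ) : ℝ) ≤ 2 ^ (k + 2) := by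
        have : (1 : ℝ) ≤ 2 ^ (k + 1) := one_le_pow₀ one_le_two
        push_cast
        rw [pow_succ _ (k + 1)]
        linarith
      refine (Real.log_le_log (by positivity) h3).trans ?_
      rw [Real.log_pow]
      have := Real.log_two_lt_d9
      push_cast
      nlinarith
    push_cast at h1 h2 ⊢
    linarith

end Lebesgue

/-! ### Stability and decay of tensor product operators -/

section Stability

variable {E : Type*} [NormedAddCommGroup E] [NormedSpace ℝ E]

/-- `K` maps functions bounded by `M` on `[lo, hi]` to functions bounded by `Λ * M`. -/
def PointKernel.StableOn (E : Type*) [NormedAddCommGroup E] [NormedSpace ℝ E] (lo hi : ℝ)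
    (K : PointKernel) (Λ : ℝ) : Prop :=
  ∀ (g : ℝ → E) (M : ℝ), (∀ x ∈ Set.Icc lo hi, ‖g x‖ ≤ M) →
    ∀ t ∈ Set.Icc lo hi, ‖K.act g t‖ ≤ Λ * M

theorem stableOn_interpKernel {lo hi : ℝ} (h : lo < hi) (k : ℕ) :
    (interpKernel lo hi (level k)).StableOn E lo hi (8 * k) := by
  intro g M hg t ht
  have hM : 0 ≤ M := (norm_nonneg _).trans (hg t ht)
  rcases Nat.eq_zero_or_pos k with rfl | hk
  · simp [level, interpKernel_zero, PointKernel.act]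
  rw [interpKernel_act]
  refine (norm_sum_le _ _).trans ?_
  calc _ ≤ ∑ j : Fin (level k),
        |(Lagrange.basis Finset.univ (ccNode lo hi (level k)) j).eval t| * M := by
        refine Finset.sum_le_sum fun j _ => ?_
        rw [norm_smul, Real.norm_eq_abs]
        exact mul_le_mul_of_nonneg_left (hg _ (ccNode_mem_Icc h.le _ j)) (abs_nonneg _)
    _ ≤ _ := by
        rw [← Finset.sum_mul]
        exact mul_le_mul_of_nonneg_right (sum_basis_ccNode_level_le h hk ht) hM

variable {N : ℕ} {lo hi : Fin N → ℝ}

theorem update_mem_paramBox {y : Fin N → ℝ} (hy : y ∈ paramBox lo hi) {n : Fin N} {x : ℝ}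
    (hx : x ∈ Set.Icc (lo n) (hi n)) : Function.update y n x ∈ paramBox lo hi := by
  intro l
  by_cases h : l = n
  · subst h; simpa using hx
  · simpa [Function.update_of_ne h] using hy l

theorem norm_tensorOp_le {K : Fin N → PointKernel} {Λ : Fin N → ℝ}
    (hK : ∀ n, (K n).StableOn E (lo n) (hi n) (Λ n)) {v : (Fin N → ℝ) → E} {M : ℝ}
    (hv : ∀ y ∈ paramBox lo hi, ‖v y‖ ≤ M) {y : Fin N → ℝ} (hy : y ∈ paramBox lo hi) :
    ‖tensorOp K v y‖ ≤ (∏ n, Λ n) * M := by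
  have key : ∀ (L : List (Fin N)) (y), y ∈ paramBox lo hi →
      ‖listOp L K v y‖ ≤ (L.map Λ).prod * M := by
    intro L
    induction L with
    | nil => intro y hy; simpa [listOp_nil] using hv y hy
    | cons n L ih =>
      intro y hy
      rw [listOp_cons, Module.End.mul_apply, List.map_cons, List.prod_cons, mul_assoc]
      exact hK n _ _ (fun x hx => ih _ (update_mem_paramBox hy hx)) _ (hy n)
  refine (key (List.finRange N) y hy).trans_eq ?_
  rw [← List.ofFn_eq_map, List.prod_ofFn]

/-- Stable tensor product operators only see the values on the parameter box. -/
theorem tensorOp_congr {K : Fin N → PointKernel} {Λ : Fin N → ℝ}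
    (hK : ∀ n, (K n).StableOn E (lo n) (hi n) (Λ n)) {v w : (Fin N → ℝ) → E}
    (hvw : ∀ y ∈ paramBox lo hi, v y = w y) {y : Fin N → ℝ} (hy : y ∈ paramBox lo hi) :
    tensorOp K v y = tensorOp K w y := by
  -- Stability with `M = 0` forces the difference to vanish.
  have := norm_tensorOp_le hK (v := v - w) (M := 0) (fun y hy => by simp [hvw y hy]) hy
  rw [map_sub, mul_zero, Pi.sub_apply, norm_le_zero_iff, sub_eq_zero] at this
  exact this

end Stability

/-! ### Supports of kernels and the resulting univariate decay bounds. -/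

section Support

variable {lo hi : ℝ}

/-- On `[lo, hi]`, the kernel only uses values on `[lo, hi]`. -/
def PointKernel.SupportedOn (lo hi : ℝ) (K : PointKernel) : Prop :=
  ∀ t ∈ Set.Icc lo hi, K (Finsupp.single t 1) ∈ Finsupp.supported ℝ ℝ (Set.Icc lo hi)

theorem PointKernel.SupportedOn.sub {K K' : PointKernel} (h : K.SupportedOn lo hi)
    (h' : K'.SupportedOn lo hi) : (K - K').SupportedOn lo hi := fun t ht => by
  rw [LinearMap.sub_apply]
  exact Submodule.sub_mem _ (h t ht) (h' t ht)

theorem PointKernel.SupportedOn.mul {K K' : PointKernel} (h : K.SupportedOn lo hi)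
    (h' : K'.SupportedOn lo hi) : (K * K').SupportedOn lo hi := fun t ht => by
  rw [Module.End.mul_apply, ← Finsupp.sum_single (K' (Finsupp.single t 1)), Finsupp.sum, map_sum]
  refine Submodule.sum_mem _ fun x hx => ?_
  rw [← mul_one ((K' (Finsupp.single t 1)) x), ← smul_eq_mul, ← Finsupp.smul_single, map_smul]
  exact Submodule.smul_mem _ _ (h x ((Finsupp.mem_supported _ _).1 (h' t ht) hx))

theorem supportedOn_coordKernel : coordKernel.SupportedOn lo hi := fun t ht => by
  rw [coordKernel_single]
  exact Finsupp.single_mem_supported _ _ ht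

theorem supportedOn_interpKernel (h : lo < hi) (m : ℕ) :
    (interpKernel lo hi m).SupportedOn lo hi := fun t _ => by
  rw [interpKernel_single]
  exact Submodule.sum_mem _ fun j _ =>
    Finsupp.single_mem_supported _ _ (ccNode_mem_Icc h.le m j)

theorem supportedOn_detailKernel (h : lo < hi) (k : ℕ) :
    (detailKernel lo hi k).SupportedOn lo hi :=
  (supportedOn_interpKernel h _).sub (supportedOn_interpKernel h _)

theorem PointKernel.SupportedOn.boundOn (h : lo < hi) {τ : ℝ} (hτ : 0 < τ) {K : PointKernel}
    (hK : K.SupportedOn lo hi) {B : ℝ} {s : ℕ}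
    (hB : ∀ k : ℤ, ∀ t ∈ Set.Icc lo hi, |K.act (fun x => (chebyshevOn lo hi k).eval x) t| ≤ B)
    (hs : ∀ k : ℤ, k.natAbs < s → ∀ t, K.act (fun x => (chebyshevOn lo hi k).eval x) t = 0) :
    K.BoundOn lo hi τ
      (B * (2 / (1 - (ellipseParam lo hi τ)⁻¹)) * (ellipseParam lo hi τ)⁻¹ ^ s) where
  support t ht _ hx := (Finsupp.mem_supported _ _).1 (hK t ht) hx
  bound _ _ hg hM t ht :=
    PointKernel.norm_act_le h hτ (fun _ hx => (Finsupp.mem_supported _ _).1 (hK t ht) hx)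
      (fun k => hB k t ht) (fun k hk => hs k hk t) hg hM

theorem boundOn_interp_detail (h : lo < hi) {τ : ℝ} (hτ : 0 < τ) {i j : ℕ} (hi' : 0 < i)
    (hij : j ≤ i) : (interpKernel lo hi (level i) * detailKernel lo hi j).BoundOn lo hi τ
      (2 * (2 / (1 - (ellipseParam lo hi τ)⁻¹)) * (ellipseParam lo hi τ)⁻¹ ^ level (j - 1)) :=
  ((supportedOn_interpKernel h _).mul (supportedOn_detailKernel h j)).boundOn h hτ
    (fun k _ ht => abs_interp_detail_act_chebyshevOn_le h hi' k ht)
    fun _ hk t => interp_detail_act_chebyshevOn_eq_zero h hij hk t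

theorem boundOn_interp_coord_detail (h : lo < hi) {τ : ℝ} (hτ : 0 < τ) {i : ℕ} (hi' : 0 < i) :
    (interpKernel lo hi (level i) * coordKernel * detailKernel lo hi (i + 1)).BoundOn lo hi τ
      ((|lo + hi| + (hi - lo)) * (2 / (1 - (ellipseParam lo hi τ)⁻¹)) *
        (ellipseParam lo hi τ)⁻¹ ^ (level i - 1)) :=
  (((supportedOn_interpKernel h _).mul supportedOn_coordKernel).mul
      (supportedOn_detailKernel h _)).boundOn h hτ
    (fun k _ ht => abs_interp_coord_detail_act_chebyshevOn_le h hi' k ht)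
    fun _ hk t => interp_coord_detail_act_chebyshevOn_eq_zero h (by omega) t

end Support

/-! ### Vector-valued functions through weak holomorphy. -/

section Decay

variable {N : ℕ} {lo hi τ : Fin N → ℝ} {E : Type*} [NormedAddCommGroup E] [NormedSpace ℝ E]

/-- `U` has a bounded holomorphic extension in the weak sense. -/
def WeaklyHolomorphic (lo hi τ : Fin N → ℝ) (M : ℝ) (U : (Fin N → ℝ) → E) : Prop :=
  ∀ φ : E →L[ℝ] ℝ, HolomorphicIn lo hi τ Set.univ (‖φ‖ * M) fun y => (φ (U y) : ℂ)

/-- Kernels commute with dual functionals, so the scalar bound applies to each `φ ∘ U` with a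
constant proportional to `‖φ‖`. -/
theorem WeaklyHolomorphic.norm_tensorOp_le (hτ : ∀ n, 0 < τ n) {M : ℝ} (hM : 0 ≤ M)
    {U : (Fin N → ℝ) → E} (hU : WeaklyHolomorphic lo hi τ M U) {K : Fin N → PointKernel}
    {ε : Fin N → ℝ} (hε : ∀ n, 0 ≤ ε n)
    (hK : ∀ n, (K n).BoundOn (lo n) (hi n) (τ n) (ε n)) {y : Fin N → ℝ}
    (hy : y ∈ paramBox lo hi) : ‖tensorOp K U y‖ ≤ (∏ n, ε n) * M := by
  refine NormedSpace.norm_le_dual_bound ℝ _ (mul_nonneg (Finset.prod_nonneg fun n _ => hε n) hM)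
    fun φ => ?_
  have h1 := (hU φ).norm_tensorOp_le hτ hK hy
  have h2 := tensorOp_map K (Complex.ofRealCLM.toLinearMap.comp φ.toLinearMap) U y
  have h3 : ((φ (tensorOp K U y) : ℝ) : ℂ) = tensorOp K (fun y' => ((φ (U y') : ℝ) : ℂ)) y := h2
  rw [← h3, Complex.norm_real] at h1
  linarith

end Decay

/-! ### Rectangular index sets and the index sets of the algorithm -/

section Rectangles

variable {N : ℕ} {i j k : Fin N → ℕ} {n : Fin N}

theorem mem_rectangle : j ∈ rectangle i ↔ ∀ l, 1 ≤ j l ∧ j l ≤ i l := by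
  simp [rectangle, Pi.le_def, forall_and]

/-- The part of the margin of a rectangle that extends it in direction `n`. -/
def marginFace (i : Fin N → ℕ) (n : Fin N) : Finset (Fin N → ℕ) :=
  Fintype.piFinset (Function.update (fun l => Finset.Icc 1 (i l)) n {i n + 1})

theorem mem_marginFace :
    j ∈ marginFace i n ↔ j n = i n + 1 ∧ ∀ l, l ≠ n → 1 ≤ j l ∧ j l ≤ i l := by
  rw [marginFace, Fintype.mem_piFinset]
  constructor
  · intro h
    refine ⟨by simpa using h n, fun l hl => ?_⟩
    simpa [Function.update_of_ne hl] using h l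
  · rintro ⟨h1, h2⟩ l
    by_cases hl : l = n
    · subst hl; simpa using h1
    · simpa [Function.update_of_ne hl] using h2 l hl

theorem add_single_same (j : Fin N → ℕ) (n : Fin N) :
    (j + Pi.single n 1 : Fin N → ℕ) n = j n + 1 := by
  simp

theorem add_single_of_ne (j : Fin N → ℕ) {l n : Fin N} (h : l ≠ n) :
    (j + Pi.single n 1 : Fin N → ℕ) l = j l := by
  simp [h]

theorem sub_single_same (j : Fin N → ℕ) (n : Fin N) :
    (j - Pi.single n 1 : Fin N → ℕ) n = j n - 1 := by
  simp

theorem sub_single_of_ne (j : Fin N → ℕ) {l n : Fin N} (h : l ≠ n) :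
    (j - Pi.single n 1 : Fin N → ℕ) l = j l := by
  simp [h]

theorem mem_margin_rectangle (hi : 1 ≤ i) :
    j ∈ margin (rectangle i) ↔ ∃ n, j ∈ marginFace i n := by
  simp only [margin, Finset.mem_sdiff, Finset.mem_biUnion, Finset.mem_image, Finset.mem_univ,
    true_and]
  constructor
  · rintro ⟨⟨k, hk, n, rfl⟩, hn⟩
    rw [mem_rectangle] at hk
    refine ⟨n, ?_⟩
    rw [mem_marginFace, add_single_same]
    have hother : ∀ l, l ≠ n → 1 ≤ (k + Pi.single n 1 : Fin N → ℕ) l ∧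
        (k + Pi.single n 1 : Fin N → ℕ) l ≤ i l := by
      intro l hl
      rw [add_single_of_ne k hl]
      exact hk l
    refine ⟨?_, hother⟩
    by_contra hne
    refine hn (mem_rectangle.2 fun l => ?_)
    by_cases hl : l = n
    · subst hl
      rw [add_single_same]
      have := hk l
      omega
    · exact hother l hl
  · rintro ⟨n, h⟩
    rw [mem_marginFace] at h
    refine ⟨⟨j - Pi.single n 1, mem_rectangle.2 fun l => ?_, n, ?_⟩, fun hj => ?_⟩
    · by_cases hl : l = n
      · subst hl
        rw [sub_single_same, h.1]
        exact ⟨by simpa using hi l, by simp⟩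
      · rw [sub_single_of_ne j hl]
        exact h.2 l hl
    · ext l
      by_cases hl : l = n
      · subst hl
        rw [add_single_same, sub_single_same]
        omega
      · rw [add_single_of_ne _ hl, sub_single_of_ne _ hl]
    · have := (mem_rectangle.1 hj n).2
      omega

theorem margin_rectangle (hi : 1 ≤ i) :
    margin (rectangle i) = Finset.univ.biUnion (marginFace i) := by
  ext j
  simp [mem_margin_rectangle hi]

theorem disjoint_marginFace {n n' : Fin N} (h : n ≠ n') :
    Disjoint (marginFace i n) (marginFace i n') := by
  rw [Finset.disjoint_left]
  intro j h1 h2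
  rw [mem_marginFace] at h1 h2
  have := h2.2 n h
  omega

theorem disjoint_rectangle_marginFace : Disjoint (rectangle i) (marginFace i n) := by
  rw [Finset.disjoint_left]
  intro j h1 h2
  rw [mem_marginFace] at h2
  have := mem_rectangle.1 h1 n
  omega

theorem rectangle_add_single :
    rectangle (i + Pi.single n 1) = rectangle i ∪ marginFace i n := by
  ext j
  rw [Finset.mem_union, mem_rectangle, mem_rectangle, mem_marginFace]
  constructor
  · intro h
    have hother : ∀ l, l ≠ n → 1 ≤ j l ∧ j l ≤ i l := fun l hl => by
      simpa [hl] using h l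
    have hn := h n
    rw [add_single_same] at hn
    by_cases hj : j n = i n + 1
    · exact Or.inr ⟨hj, hother⟩
    · refine Or.inl fun l => ?_
      by_cases hl : l = n
      · subst hl; omega
      · exact hother l hl
  · rintro (h | h) l
    · have := h l
      rw [Pi.add_apply]
      omega
    · by_cases hl : l = n
      · subst hl
        rw [add_single_same]
        omega
      · rw [add_single_of_ne i hl]
        exact h.2 l hl

/-- Induction on the total excess of `j` over `k`, lowering one coordinate that is too large. -/
theorem IsDownwardClosed.mem_of_le {B : Finset (Fin N → ℕ)} (hB : IsDownwardClosed B)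
    (hk : 1 ≤ k) (hkj : k ≤ j) (hj : j ∈ B) : k ∈ B := by
  obtain ⟨s, hs⟩ : ∃ s, s = ∑ l, (j l - k l) := ⟨_, rfl⟩
  induction s using Nat.strong_induction_on generalizing j with
  | _ s ih =>
    by_cases h : k = j
    · rwa [h]
    · obtain ⟨l, hl⟩ : ∃ l, k l < j l := by
        by_contra! hcon
        exact h (le_antisymm hkj fun l => hcon l)
      have hkl : 1 ≤ k l := hk l
      have hle : k ≤ j - Pi.single l 1 := fun m => by
        by_cases hm : m = l
        · subst hm
          rw [sub_single_same]
          exact Nat.le_sub_one_of_lt hl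
        · rw [sub_single_of_ne j hm]
          exact hkj m
      refine ih _ ?_ hle (hB j hj l (by omega)) rfl
      rw [hs]
      refine Finset.sum_lt_sum (fun m _ => ?_) ⟨l, Finset.mem_univ _, ?_⟩
      · rw [Pi.sub_apply]
        omega
      · rw [sub_single_same]
        omega

-- The points of the face below `j` already extend the rectangle to a downward closed set, since
-- lowering direction `n` lands in the rectangle. Conversely, every downward closed extension
-- containing `j` contains all positive `k ≤ j`.
open Classical in
theorem closureInMargin_rectangle (hi : 1 ≤ i) (hj : j ∈ marginFace i n) :
    closureInMargin j (rectangle i) = (marginFace i n).filter (· ≤ j) := by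
  ext k
  rw [closureInMargin, Finset.mem_filter, Finset.mem_filter]
  constructor
  · rintro ⟨-, h⟩
    refine Finset.mem_filter.1 (h ((marginFace i n).filter (· ≤ j)) ?_ (by simp [hj]) ?_)
    · rw [margin_rectangle hi]
      exact (Finset.filter_subset _ _).trans (Finset.subset_biUnion_of_mem _ (Finset.mem_univ n))
    · intro m hm l hl
      rw [Finset.mem_union, Finset.mem_filter] at hm ⊢
      rcases hm with hm | ⟨hm, hmj⟩
      · refine Or.inl (mem_rectangle.2 fun l' => ?_)
        have := mem_rectangle.1 hm l'
        by_cases hll : l' = l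
        · subst hll
          rw [sub_single_same]
          omega
        · rwa [sub_single_of_ne m hll]
      · rw [mem_marginFace] at hm
        by_cases hln : l = n
        · subst hln
          refine Or.inl (mem_rectangle.2 fun l' => ?_)
          by_cases hll : l' = l
          · subst hll
            rw [sub_single_same]
            omega
          · rw [sub_single_of_ne m hll]
            exact hm.2 l' hll
        · refine Or.inr ⟨mem_marginFace.2 ⟨?_, fun l' hl' => ?_⟩, ?_⟩
          · rw [sub_single_of_ne m (Ne.symm hln)]
            exact hm.1
          · have := hm.2 l' hl'
            by_cases hll : l' = l
            · subst hll
              rw [sub_single_same]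
              omega
            · rwa [sub_single_of_ne m hll]
          · exact (show m - Pi.single l 1 ≤ m from fun l' => by
              exact Nat.sub_le _ _).trans hmj
  · rintro ⟨hk, hkj⟩
    refine ⟨(mem_margin_rectangle hi).2 ⟨n, hk⟩, fun B _ hjB hB => ?_⟩
    rw [mem_marginFace] at hk
    have hk1 : 1 ≤ k := fun l => by
      by_cases hl : l = n
      · subst hl
        have := hk.1
        simp only [Pi.one_apply]
        omega
      · exact (hk.2 l hl).1
    have := hB.mem_of_le hk1 hkj (Finset.mem_union_right _ hjB)
    refine (Finset.mem_union.1 this).resolve_left fun h => ?_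
    have := mem_rectangle.1 h n
    omega

theorem add_single_mem_marginFace (hi : 1 ≤ i) (n : Fin N) :
    i + Pi.single n 1 ∈ marginFace i n := by
  rw [mem_marginFace, add_single_same]
  refine ⟨rfl, fun l hl => ?_⟩
  rw [add_single_of_ne i hl]
  exact ⟨hi l, le_rfl⟩

theorem le_add_single_of_mem_marginFace (hj : j ∈ marginFace i n) : j ≤ i + Pi.single n 1 := by
  rw [mem_marginFace] at hj
  intro l
  by_cases hl : l = n
  · subst hl
    rw [add_single_same, hj.1]
  · rw [add_single_of_ne i hl]
    exact (hj.2 l hl).2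

open Classical in
theorem closureInMargin_add_single (hi : 1 ≤ i) (n : Fin N) :
    closureInMargin (i + Pi.single n 1) (rectangle i) = marginFace i n := by
  rw [closureInMargin_rectangle hi (add_single_mem_marginFace hi n), Finset.filter_true_of_mem]
  exact fun k hk => le_add_single_of_mem_marginFace hk

end Rectangles

/-! ### The index sets along a run. -/

section Runs

variable {d N : ℕ} {D : Set (Space d)} {lo hi : Fin N → ℝ} {a₀ : LInf D} {a : Fin N → LInf D}
  {u : (Fin N → ℝ) → H10 D}

theorem estimator_nonneg (i : Fin N → ℕ) (I : Finset (Fin N → ℕ)) :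
    0 ≤ estimator lo hi a₀ a u i I :=
  Real.iSup_nonneg fun _ => norm_nonneg _

open Classical in
/-- One step of the algorithm enriches a rectangle in exactly one direction. -/
theorem IsWorklessRun.exists_add_single {I : ℕ → Finset (Fin N → ℕ)} {i : ℕ → Fin N → ℕ}
    (h : IsWorklessRun lo hi a₀ a u I i) {ℓ : ℕ} (hℓ : 0 < ℓ) {r : Fin N → ℕ} (hr : 1 ≤ r)
    (hI : I ℓ = rectangle r) : ∃ n, i ℓ = r + Pi.single n 1 := by
  have hm := h.mem_margin ℓ hℓ
  have hmax := h.profit_max ℓ hℓ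
  have htie := h.tie_break ℓ hℓ
  rw [hI] at hm hmax htie
  obtain ⟨n, hn⟩ := (mem_margin_rectangle hr).1 hm
  have hj := add_single_mem_marginFace hr n
  have hjm : r + Pi.single n 1 ∈ margin (rectangle r) := (mem_margin_rectangle hr).2 ⟨n, hj⟩
  -- The corner of the face dominates `i ℓ` and its closure is the whole face, so its profit is no
  -- smaller; the tie-breaking rule then identifies the two.
  refine ⟨n, (htie _ hjm (le_antisymm (hmax _ hjm) ?_) (le_add_single_of_mem_marginFace hn)).symm⟩
  rw [worklessProfit, worklessProfit, closureInMargin_add_single hr,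
    closureInMargin_rectangle hr hn]
  exact Finset.sum_le_sum_of_subset_of_nonneg (Finset.filter_subset _ _)
    fun _ _ _ => estimator_nonneg _ _

theorem IsWorklessRun.rectangle {I : ℕ → Finset (Fin N → ℕ)} {i : ℕ → Fin N → ℕ}
    (h : IsWorklessRun lo hi a₀ a u I i) (ℓ : ℕ) :
    1 ≤ i ℓ ∧ I (ℓ + 1) = rectangle (i ℓ) := by
  induction ℓ with
  | zero =>
    refine ⟨h.init_index.ge, ?_⟩
    rw [h.init_index, zero_add, h.init_set, SparseCollocation.rectangle, Finset.Icc_self]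
  | succ ℓ ih =>
    obtain ⟨n, hn⟩ := h.exists_add_single (Nat.succ_pos ℓ) ih.1 ih.2
    refine ⟨?_, ?_⟩
    · rw [hn]
      exact ih.1.trans (le_add_of_nonneg_right (by intro l; simp))
    · rw [h.step _ (Nat.succ_pos ℓ), hn, ih.2, closureInMargin_add_single ih.1,
        rectangle_add_single]

theorem IsWorklessRun.exists_step {I : ℕ → Finset (Fin N → ℕ)} {i : ℕ → Fin N → ℕ}
    (h : IsWorklessRun lo hi a₀ a u I i) (ℓ : ℕ) : ∃ n, i (ℓ + 1) = i ℓ + Pi.single n 1 :=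
  h.exists_add_single (Nat.succ_pos ℓ) (h.rectangle ℓ).1 (h.rectangle ℓ).2

theorem IsWorklessRun.sum_index {I : ℕ → Finset (Fin N → ℕ)} {i : ℕ → Fin N → ℕ}
    (h : IsWorklessRun lo hi a₀ a u I i) (ℓ : ℕ) : ∑ n, i ℓ n = N + ℓ := by
  induction ℓ with
  | zero => simp [h.init_index]
  | succ ℓ ih =>
    obtain ⟨n, hn⟩ := h.exists_step ℓ
    rw [hn]
    simp [Finset.sum_add_distrib, ih, add_assoc]

theorem IsWorklessRun.monotone {I : ℕ → Finset (Fin N → ℕ)} {i : ℕ → Fin N → ℕ}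
    (h : IsWorklessRun lo hi a₀ a u I i) : Monotone i := by
  refine monotone_nat_of_le_succ fun ℓ => ?_
  obtain ⟨n, hn⟩ := h.exists_step ℓ
  rw [hn]
  exact le_add_of_nonneg_right (by intro l; simp)

/-- The last step at which direction `n` was enriched. -/
theorem IsWorklessRun.exists_last_step {I : ℕ → Finset (Fin N → ℕ)} {i : ℕ → Fin N → ℕ}
    (h : IsWorklessRun lo hi a₀ a u I i) {n : Fin N} {ℓ : ℕ} (hn : 1 < i ℓ n) :
    ∃ p < ℓ, i (p + 1) = i p + Pi.single n 1 ∧ i p n + 1 = i ℓ n := by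
  induction ℓ with
  | zero => simp [h.init_index] at hn
  | succ ℓ ih =>
    obtain ⟨l, hl⟩ := h.exists_step ℓ
    by_cases hln : l = n
    · subst hln
      exact ⟨ℓ, Nat.lt_succ_self ℓ, hl, by rw [hl, add_single_same]⟩
    · have heq : i (ℓ + 1) n = i ℓ n := by rw [hl, add_single_of_ne _ (Ne.symm hln)]
      rw [heq] at hn ⊢
      obtain ⟨p, hp, h1, h2⟩ := ih hn
      exact ⟨p, hp.trans (Nat.lt_succ_self ℓ), h1, h2⟩

end Runs

/-! ### Multiplication by the coefficient and exactness of the sparse grid operators -/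

section Exactness

variable {N : ℕ} {E : Type*} [AddCommGroup E] [Module ℝ E] {lo hi : Fin N → ℝ}

theorem tensorOp_interpKernels_const (h : ∀ n, lo n < hi n) {i : Fin N → ℕ} (hi' : 1 ≤ i)
    (c : E) : tensorOp (interpKernels lo hi i) (fun _ => c) = fun _ : Fin N → ℝ => c := by
  unfold tensorOp
  induction List.finRange N with
  | nil => rfl
  | cons n L ih =>
    rw [listOp_cons, Module.End.mul_apply, ih]
    ext y
    rw [lift_apply, interpKernels, interpKernel_act, ← Finset.sum_smul]
    have hdeg : (1 : Polynomial ℝ).degree < (level (i n) : WithBot ℕ) := by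
      rw [Polynomial.degree_one]
      exact_mod_cast level_pos (hi' n)
    have := sum_basis_eval_mul (h n) hdeg (y n)
    simp only [Polynomial.eval_one, mul_one] at this
    rw [this, one_smul]

/-- `Δ^{m(j)} U_{m(i)}` vanishes if `j` exceeds `i` in some direction. -/
theorem detail_mul_interp_eq_zero (h : ∀ n, lo n < hi n) {i j : Fin N → ℕ} {n : Fin N}
    (hn : j n = i n + 1) :
    (tensorOp (detailKernels lo hi j) * tensorOp (interpKernels lo hi i) :
      Module.End ℝ ((Fin N → ℝ) → E)) = 0 := by
  rw [tensorOp_mul]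
  refine tensorOp_eq_zero n ?_
  rw [interpKernels, detailKernels]
  exact interpKernel_mul_detailKernel (h n) (by rw [hn, Nat.add_sub_cancel])

theorem detail_mul_coord_mul_interp_eq_zero (h : ∀ n, lo n < hi n) {i j : Fin N → ℕ}
    {n l : Fin N} (hn : j n = i n + 1) (hl : l ≠ n) :
    (tensorOp (detailKernels lo hi j) * (lift l coordKernel * tensorOp (interpKernels lo hi i)) :
      Module.End ℝ ((Fin N → ℝ) → E)) = 0 := by
  rw [lift_mul_tensorOp, tensorOp_mul]
  refine tensorOp_eq_zero n ?_
  rw [Function.update_of_ne hl.symm, interpKernels, detailKernels]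
  exact interpKernel_mul_detailKernel (h n) (by rw [hn, Nat.add_sub_cancel])

/-- The univariate factors of `Δ^{m(j)} yₙ U_{m(i)}`. -/
def detailCoordKernels (lo hi : Fin N → ℝ) (i j : Fin N → ℕ) (n : Fin N) :
    Fin N → PointKernel :=
  Function.update (fun l => interpKernel (lo l) (hi l) (level (i l)) *
    detailKernel (lo l) (hi l) (j l)) n
    (interpKernel (lo n) (hi n) (level (i n)) * coordKernel * detailKernel (lo n) (hi n) (j n))

theorem detail_mul_coord_mul_interp (i j : Fin N → ℕ) (n : Fin N) :
    (tensorOp (detailKernels lo hi j) * (lift n coordKernel * tensorOp (interpKernels lo hi i)) :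
      Module.End ℝ ((Fin N → ℝ) → E)) = tensorOp (detailCoordKernels lo hi i j n) := by
  rw [lift_mul_tensorOp, tensorOp_mul]
  congr 1
  ext1 l
  by_cases hl : l = n
  · subst hl
    simp [detailCoordKernels, interpKernels, detailKernels]
  · simp [detailCoordKernels, interpKernels, detailKernels, Function.update_of_ne hl]

theorem interp_mul_interp (h : ∀ n, lo n < hi n) {i j : Fin N → ℕ} (hij : i ≤ j) :
    (tensorOp (interpKernels lo hi j) * tensorOp (interpKernels lo hi i) :
      Module.End ℝ ((Fin N → ℝ) → E)) = tensorOp (interpKernels lo hi i) := by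
  rw [tensorOp_mul]
  congr 1
  ext1 n
  exact interpKernel_mul_interpKernel (h n) (level_mono (hij n))

theorem interp_mul_coord_mul_interp (h : ∀ n, lo n < hi n) (i : Fin N → ℕ) (n : Fin N) :
    (tensorOp (interpKernels lo hi i) * (lift n coordKernel * tensorOp (interpKernels lo hi i)) :
      Module.End ℝ ((Fin N → ℝ) → E)) =
      tensorOp (interpKernels lo hi i) * lift n coordKernel := by
  rw [lift_mul_tensorOp, tensorOp_mul, tensorOp_mul_lift]
  congr 1
  ext1 l
  by_cases hl : l = n
  · subst hl
    simp only [Function.update_self]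
    exact interpKernel_mul_coordKernel_mul_self (h l) _
  · simp only [Function.update_of_ne hl]
    exact interpKernel_mul_interpKernel (h l) le_rfl

theorem interp_add_single_mul_coord_mul_interp (h : ∀ n, lo n < hi n) (i : Fin N → ℕ)
    (n : Fin N) :
    (tensorOp (interpKernels lo hi (i + Pi.single n 1)) *
      (lift n coordKernel * tensorOp (interpKernels lo hi i)) :
      Module.End ℝ ((Fin N → ℝ) → E)) = lift n coordKernel * tensorOp (interpKernels lo hi i) := by
  rw [lift_mul_tensorOp, tensorOp_mul]
  congr 1
  ext1 l
  by_cases hl : l = n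
  · subst hl
    simp only [Function.update_self, interpKernels, add_single_same]
    exact interpKernel_mul_coordKernel_mul_interpKernel (h l)
      (level_strictMono (Nat.lt_succ_self _))
  · simp only [Function.update_of_ne hl, interpKernels, add_single_of_ne i hl]
    exact interpKernel_mul_interpKernel (h l) le_rfl

theorem interp_rectangle_eq_sum (i : Fin N → ℕ) :
    (tensorOp (interpKernels lo hi i) : Module.End ℝ ((Fin N → ℝ) → E)) =
      ∑ j ∈ rectangle i, tensorOp (detailKernels lo hi j) := by
  ext v y
  rw [← sparseInterp_rectangle]
  simp [sparseInterp, surplus_eq_tensorOp]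

/-- The rectangle reproduces its own interpolants, while each margin index exceeds `i` in some
direction and annihilates them. -/
theorem interp_add_sum_margin_interp (h : ∀ n, lo n < hi n) {i : Fin N → ℕ} (hi' : 1 ≤ i) :
    ((tensorOp (interpKernels lo hi i) + ∑ j ∈ margin (rectangle i),
      tensorOp (detailKernels lo hi j)) * tensorOp (interpKernels lo hi i) :
      Module.End ℝ ((Fin N → ℝ) → E)) = tensorOp (interpKernels lo hi i) := by
  rw [add_mul, interp_mul_interp h le_rfl, Finset.sum_mul, Finset.sum_eq_zero, add_zero]
  intro j hj
  obtain ⟨n, hn⟩ := (mem_margin_rectangle hi').1 hj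
  exact detail_mul_interp_eq_zero h (mem_marginFace.1 hn).1

/-- Only face `n` acts on `yₙ` times an interpolant. Together with the rectangle it forms the
interpolation on `R_{i + eₙ}`, whose additional nodes absorb the factor `yₙ`. -/
theorem interp_add_sum_margin_coord (h : ∀ n, lo n < hi n) {i : Fin N → ℕ} (hi' : 1 ≤ i)
    (n : Fin N) :
    ((tensorOp (interpKernels lo hi i) + ∑ j ∈ margin (rectangle i),
      tensorOp (detailKernels lo hi j)) * (lift n coordKernel * tensorOp (interpKernels lo hi i)) :
      Module.End ℝ ((Fin N → ℝ) → E)) = lift n coordKernel * tensorOp (interpKernels lo hi i) := by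
  rw [margin_rectangle hi', Finset.sum_biUnion fun n _ n' _ hn => disjoint_marginFace hn,
    ← Finset.add_sum_erase _ _ (Finset.mem_univ n), ← add_assoc, add_mul,
    interp_rectangle_eq_sum i, ← Finset.sum_union disjoint_rectangle_marginFace,
    ← rectangle_add_single, ← interp_rectangle_eq_sum, ← interp_rectangle_eq_sum,
    interp_add_single_mul_coord_mul_interp h, add_eq_left, Finset.sum_mul]
  refine Finset.sum_eq_zero fun n' hn' => ?_
  rw [Finset.sum_mul]
  exact Finset.sum_eq_zero fun j hj =>
    detail_mul_coord_mul_interp_eq_zero h (mem_marginFace.1 hj).1 (Finset.ne_of_mem_erase hn').symm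

end Exactness

/-! ### Reliability of the estimator -/

section Reliability

variable {d N : ℕ} {D : Set (Space d)}

/-- Multiplication of a vector field by a bounded function. -/
def mulField : LInf D →ₗ[ℝ] L2Vec D →ₗ[ℝ] L2Vec D :=
  LinearMap.mk₂ ℝ (fun b w => (b • w : L2Vec D)) (fun b b' w => Lp.smul_add b b' w)
    (fun c b w => Lp.smul_assoc c b w) (fun b w w' => Lp.add_smul b w w')
    (fun c b w => (Lp.smul_comm c b w).symm)

theorem mulField_apply (b : LInf D) (w : L2Vec D) : mulField b w = (b • w : L2Vec D) := rfl

theorem norm_mulField_le (b : LInf D) (w : L2Vec D) : ‖mulField b w‖ ≤ ‖b‖ * ‖w‖ :=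
  Lp.norm_smul_le b w

theorem mulField_coeff (a₀ : LInf D) (a : Fin N → LInf D) (y : Fin N → ℝ) (w : L2Vec D) :
    mulField (coeff a₀ a y) w = mulField a₀ w + ∑ n, mulField (a n) (y n • w) := by
  simp [coeff]

theorem inner_mulField (b : LInf D) (w w' : L2Vec D) :
    inner ℝ (mulField b w) w' = ∫ x in D, b x * inner ℝ (w x) (w' x) := by
  rw [L2.inner_def]
  refine integral_congr_ae ?_
  filter_upwards [Lp.coeFn_lpSMul (r := 2) b w] with x hx
  rw [mulField_apply, hx, Pi.smul_apply', inner_smul_left]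
  rfl

theorem le_inner_mulField {b : LInf D} {c : ℝ} (hb : ∀ᵐ x ∂(vol D), c ≤ b x) (w : L2Vec D) :
    c * ‖w‖ ^ 2 ≤ inner ℝ (mulField b w) w := by
  rw [← real_inner_self_eq_norm_sq, L2.inner_def, L2.inner_def, ← integral_const_mul]
  refine integral_mono_ae ((L2.integrable_inner w w).const_mul c)
    (L2.integrable_inner (mulField b w) w) ?_
  filter_upwards [hb, Lp.coeFn_lpSMul (r := 2) b w] with x hx hx'
  rw [mulField_apply, hx', Pi.smul_apply', inner_smul_left]
  exact mul_le_mul_of_nonneg_right hx real_inner_self_nonneg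

/-- The gradient as a continuous linear map. -/
def gradL : H10 D →L[ℝ] L2Vec D :=
  (ContinuousLinearMap.snd ℝ (L2 D) (L2Vec D)).comp (H10 D).subtypeL

theorem gradL_apply (v : H10 D) : gradL v = grad v := rfl

variable {lo hi : Fin N → ℝ} {a₀ : LInf D} {a : Fin N → LInf D} {u : (Fin N → ℝ) → H10 D}

/-- The flux `a ∇S_I[u]` on a rectangle. -/
def flux (lo hi : Fin N → ℝ) (a₀ : LInf D) (a : Fin N → LInf D) (u : (Fin N → ℝ) → H10 D)
    (i : Fin N → ℕ) (y : Fin N → ℝ) : L2Vec D :=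
  mulField (coeff a₀ a y) (tensorOp (interpKernels lo hi i) (fun y' => grad (u y')) y)

theorem grad_sparseInterp (i : Fin N → ℕ) (y : Fin N → ℝ) :
    grad (sparseInterp lo hi (rectangle i) u y) =
      tensorOp (interpKernels lo hi i) (fun y' => grad (u y')) y := by
  rw [sparseInterp_rectangle, ← gradL_apply]
  exact tensorOp_map _ gradL.toLinearMap u y

theorem flux_eq (i : Fin N → ℕ) (y : Fin N → ℝ) :
    flux lo hi a₀ a u i y =
      (coeff a₀ a y • grad (sparseInterp lo hi (rectangle i) u y) : L2Vec D) := by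
  rw [grad_sparseInterp]
  rfl

theorem tensorOp_mulField_coeff (K : Fin N → PointKernel) (w : (Fin N → ℝ) → L2Vec D)
    (y : Fin N → ℝ) :
    tensorOp K (fun y' => mulField (coeff a₀ a y') (w y')) y =
      mulField a₀ (tensorOp K w y) + ∑ n, mulField (a n) (tensorOp K (lift n coordKernel w) y) := by
  have h : (fun y' => mulField (coeff a₀ a y') (w y')) = (fun y' => mulField a₀ (w y')) +
      ∑ n, fun y' => mulField (a n) (lift n coordKernel w y') := by
    ext1 y'
    rw [Pi.add_apply, Finset.sum_apply, mulField_coeff]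
    simp only [lift_apply, coordKernel_act, Function.update_eq_self]
  rw [h, map_add, map_sum, Pi.add_apply, Finset.sum_apply, tensorOp_map]
  simp only [tensorOp_map]

/-- Since `j` exceeds `i` in direction `n`, the surplus annihilates whatever has not gained degree
in `yₙ`: the `a₀` term and all `a_l y_l` with `l ≠ n`. -/
theorem surplus_flux (h : ∀ n, lo n < hi n) {i j : Fin N → ℕ} {n : Fin N}
    (hj : j ∈ marginFace i n) (y : Fin N → ℝ) :
    tensorOp (detailKernels lo hi j) (flux lo hi a₀ a u i) y =
      mulField (a n) (tensorOp (detailCoordKernels lo hi i j n) (fun y' => grad (u y')) y) := by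
  have hjn := (mem_marginFace.1 hj).1
  have h0 := detail_mul_interp_eq_zero (E := L2Vec D) h hjn
  have h1 := fun l (hl : l ≠ n) => detail_mul_coord_mul_interp_eq_zero (E := L2Vec D) h hjn hl
  have h2 := detail_mul_coord_mul_interp (E := L2Vec D) (lo := lo) (hi := hi) i j n
  unfold flux
  rw [tensorOp_mulField_coeff, ← Module.End.mul_apply, h0, LinearMap.zero_apply, Pi.zero_apply,
    map_zero, zero_add, Finset.sum_eq_single n]
  · rw [← Module.End.mul_apply (lift n coordKernel), ← Module.End.mul_apply, h2]
  · intro l _ hl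
    rw [← Module.End.mul_apply (lift l coordKernel), ← Module.End.mul_apply, h1 l hl,
      LinearMap.zero_apply, Pi.zero_apply, map_zero]
  · simp

/-- The flux consists of interpolants and coordinates times interpolants, because `a` is affine in
`y`; on both the rectangle together with its margin is exact. -/
theorem flux_eq_interp_add_sum (h : ∀ n, lo n < hi n) {i : Fin N → ℕ} (hi' : 1 ≤ i)
    (y : Fin N → ℝ) :
    flux lo hi a₀ a u i y = tensorOp (interpKernels lo hi i) (flux lo hi a₀ a u i) y +
      ∑ j ∈ margin (rectangle i),
        tensorOp (detailKernels lo hi j) (flux lo hi a₀ a u i) y := by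
  have h0 := interp_add_sum_margin_interp (E := L2Vec D) h hi'
  have h1 := interp_add_sum_margin_coord (E := L2Vec D) h hi'
  have e0 := fun v => congrFun (LinearMap.congr_fun h0 v) y
  have e1 := fun n v => congrFun (LinearMap.congr_fun (h1 n) v) y
  simp only [Module.End.mul_apply, LinearMap.add_apply, LinearMap.sum_apply, Pi.add_apply,
    Finset.sum_apply] at e0 e1
  unfold flux
  simp only [tensorOp_mulField_coeff]
  have hY : ∀ n (w : (Fin N → ℝ) → L2Vec D), y n • w y = lift n coordKernel w y := by
    intro n w
    rw [lift_apply, coordKernel_act, Function.update_eq_self]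
  rw [mulField_coeff, Finset.sum_add_distrib, Finset.sum_comm, add_add_add_comm,
    ← Finset.sum_add_distrib, ← map_sum, ← map_add]
  simp only [← map_sum, ← map_add]
  refine congrArg₂ (· + ·) (congrArg _ (e0 _).symm) (Finset.sum_congr rfl fun n _ => ?_)
  rw [hY]
  exact congrArg _ (e1 n _).symm

/-- Interpolation sees the flux only at the nodes, where `S[u]` coincides with `u`. -/
theorem interp_flux (h : ∀ n, lo n < hi n) (i : Fin N → ℕ) (y : Fin N → ℝ) :
    tensorOp (interpKernels lo hi i) (flux lo hi a₀ a u i) y =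
      tensorOp (interpKernels lo hi i) (fun y' => mulField (coeff a₀ a y') (grad (u y'))) y := by
  unfold flux
  rw [tensorOp_mulField_coeff, tensorOp_mulField_coeff]
  have h0 := interp_mul_interp (E := L2Vec D) h (le_refl i)
  have h1 := fun n => interp_mul_coord_mul_interp (E := L2Vec D) h i n
  rw [← Module.End.mul_apply, h0]
  congr 1
  refine Finset.sum_congr rfl fun n _ => ?_
  rw [← Module.End.mul_apply (lift n coordKernel), ← Module.End.mul_apply, h1,
    Module.End.mul_apply]

theorem normV_eq (v : H10 D) : normV v = ‖grad v‖ := rfl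

/-- The Galerkin orthogonality of the interpolated flux. -/
theorem inner_interp_flux (h : ∀ n, lo n < hi n) {f : L2 D} (hu : IsSolution lo hi a₀ a f u)
    {i : Fin N → ℕ} (hi' : 1 ≤ i) (v : H10 D) {y : Fin N → ℝ} (hy : y ∈ paramBox lo hi) :
    inner ℝ (tensorOp (interpKernels lo hi i) (flux lo hi a₀ a u i) y) (grad v) =
      ∫ x in D, f x * val v x := by
  rw [interp_flux h]
  have h1 := tensorOp_map (interpKernels lo hi i) ((innerₗ (L2Vec D)).flip (grad v))
    (fun y' => mulField (coeff a₀ a y') (grad (u y'))) y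
  simp only [LinearMap.flip_apply, innerₗ_apply_apply] at h1
  -- With `v` frozen, the weak equation gives the same number at every parameter, and interpolation
  -- preserves constants.
  rw [h1, tensorOp_congr (K := interpKernels lo hi i)
    (fun n => stableOn_interpKernel (h n) (i n)) (w := fun _ => ∫ x in D, f x * val v x)
    (fun y' hy' => by rw [inner_mulField]; exact hu y' hy' v) hy,
    tensorOp_interpKernels_const h hi']

/-- Coercivity is tested with the error itself. The exact flux and the interpolated discrete flux
both pair with `v` to `∫ f v` and cancel; Cauchy–Schwarz bounds the remaining margin details. -/
theorem amin_mul_normV_le (h : ∀ n, lo n < hi n) {amin : ℝ}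
    (ha : ∀ y ∈ paramBox lo hi, ∀ᵐ x ∂(vol D), amin ≤ coeff a₀ a y x)
    {f : L2 D} (hu : IsSolution lo hi a₀ a f u) {i : Fin N → ℕ} (hi' : 1 ≤ i)
    {y : Fin N → ℝ} (hy : y ∈ paramBox lo hi) :
    amin * normV (u y - sparseInterp lo hi (rectangle i) u y) ≤
      ∑ j ∈ margin (rectangle i),
        ‖tensorOp (detailKernels lo hi j) (flux lo hi a₀ a u i) y‖ := by
  set v := u y - sparseInterp lo hi (rectangle i) u y with hv
  have hgrad : grad v = grad (u y) - grad (sparseInterp lo hi (rectangle i) u y) := rfl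
  have h1 := le_inner_mulField (ha y hy) (grad v)
  have h2 : mulField (coeff a₀ a y) (grad v) =
      mulField (coeff a₀ a y) (grad (u y)) - flux lo hi a₀ a u i y := by
    rw [hgrad, map_sub, flux_eq]
    rfl
  rw [h2, flux_eq_interp_add_sum h hi', inner_sub_left, inner_add_left,
    inner_interp_flux h hu hi' v hy,
    inner_mulField, hu y hy v, sub_add_cancel_left, sum_inner, ← Finset.sum_neg_distrib] at h1
  have h3 : amin * ‖grad v‖ ^ 2 ≤ (∑ j ∈ margin (rectangle i),
      ‖tensorOp (detailKernels lo hi j) (flux lo hi a₀ a u i) y‖) * ‖grad v‖ := by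
    refine h1.trans ?_
    rw [Finset.sum_mul]
    refine Finset.sum_le_sum fun j _ => ?_
    exact (neg_le_abs _).trans (abs_real_inner_le_norm _ _)
  rw [normV_eq]
  rcases (norm_nonneg (grad v)).eq_or_lt with h0 | h0
  · rw [← h0, mul_zero]
    exact Finset.sum_nonneg fun _ _ => norm_nonneg _
  · refine le_of_mul_le_mul_right ?_ h0
    rwa [mul_assoc, ← sq]

end Reliability

/-! ### From the extension of `u` to scalar holomorphic functions. -/

section Extension

variable {d N : ℕ} {D : Set (Space d)} {lo hi τ : Fin N → ℝ} {u : (Fin N → ℝ) → H10 D}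

theorem mem_interior_polystrip {z : Fin N → ℂ}
    (hz : ∀ n, z n ∈ openStrip (lo n) (hi n) (τ n)) : z ∈ interior (polystrip lo hi τ) := by
  have hopen : IsOpen {z : Fin N → ℂ | ∀ n, z n ∈ openStrip (lo n) (hi n) (τ n)} := by
    simp only [Set.ofPred_forall]
    refine isOpen_iInter_of_finite fun n => ?_
    exact isOpen_lt ((Metric.continuous_infDist_pt _).comp (continuous_apply n)) continuous_const
  refine interior_maximal (fun z hz n => ?_) hopen hz
  exact le_of_lt (hz n)

theorem HasBoundedHolomorphicExtension.weaklyHolomorphic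
    (hext : HasBoundedHolomorphicExtension lo hi τ u) :
    ∃ M, 0 ≤ M ∧ WeaklyHolomorphic lo hi τ M fun y => grad (u y) := by
  obtain ⟨p, q, hd, ⟨M, hM⟩, hpq⟩ := hext
  refine ⟨2 * |M|, by positivity, fun φ => ?_⟩
  refine ⟨fun z => (φ (grad (p z)) : ℂ) + Complex.I * (φ (grad (q z)) : ℂ), ?_, ?_⟩
  · intro y hy
    obtain ⟨h1, h2⟩ := hpq y hy
    simp [h1, h2, ← gradL_apply]
  · intro z hz
    have hz' := mem_interior_polystrip hz.1
    refine ⟨?_, fun n _ => ?_⟩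
    · obtain ⟨h1, h2⟩ := hM z hz'
      have hb : ∀ w : H10 D, normV w ≤ M → ‖((φ (grad w) : ℝ) : ℂ)‖ ≤ ‖φ‖ * |M| := by
        intro w hw
        rw [Complex.norm_real]
        refine (φ.le_opNorm _).trans (mul_le_mul_of_nonneg_left ?_ (norm_nonneg _))
        exact hw.trans (le_abs_self M)
      refine (norm_add_le _ _).trans ?_
      rw [norm_mul, Complex.norm_I, one_mul]
      linarith [hb _ h1, hb _ h2]
    · obtain ⟨P, Q, hP, hQ, hPQ⟩ := hd z hz'
      have hup := hasFDerivAt_update (𝕜 := ℝ) z (i := n) (z n)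
      set ι : ℂ →L[ℝ] (Fin N → ℂ) := .pi (Pi.single n (.id ℝ ℂ)) with hι
      have hιI : ∀ t : ℂ, ι t = t.re • ι 1 + t.im • (Complex.I • ι 1) := by
        intro t
        ext l
        by_cases hl : l = n
        · subst hl
          simp [hι, Complex.re_add_im]
        · simp [hι, Pi.single_eq_of_ne hl]
      have hz'' : Function.update z n (z n) = z := Function.update_eq_self n z
      rw [← hz''] at hP hQ
      let ψ : H10 D →L[ℝ] ℂ := Complex.ofRealCLM.comp (φ.comp gradL)
      have hL : HasFDerivAt (fun t => ψ (p (Function.update z n t)) +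
          Complex.I • ψ (q (Function.update z n t)))
          (ψ.comp (P.comp ι) + Complex.I • ψ.comp (Q.comp ι)) (z n) :=
        (ψ.hasFDerivAt.comp (z n) (hP.comp (z n) hup)).add
          ((ψ.hasFDerivAt.comp (z n) (hQ.comp (z n) hup)).const_smul Complex.I)
      -- The relations between `P` and `Q` are the Cauchy–Riemann equations: they make the real
      -- derivative along the `n`-th axis multiplication by its value at 1.
      refine (hasFDerivAt_of_restrictScalars ℝ hL
        (f' := (1 : ℂ →L[ℂ] ℂ).smulRight (ψ (P (ι 1)) + Complex.I * ψ (Q (ι 1))))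
        ?_).differentiableAt
      ext1 t
      obtain ⟨h1, h2⟩ := hPQ (ι 1)
      simp only [ContinuousLinearMap.coe_restrictScalars', ContinuousLinearMap.smulRight_apply,
        one_apply_eq_self, smul_eq_mul, add_apply,
        ContinuousLinearMap.comp_apply, smul_apply]
      rw [hιI t]
      simp only [map_add, map_smul, h1, h2, map_neg, Complex.real_smul]
      conv_lhs => rw [← Complex.re_add_im t]
      linear_combination (t.im * ψ (Q (ι 1))) * Complex.I_mul_I

end Extension

/-! ### Decay of the workless profit -/

section Profit

variable {d N : ℕ} {D : Set (Space d)} {lo hi τ : Fin N → ℝ} {a₀ : LInf D}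
  {a : Fin N → LInf D} {u : (Fin N → ℝ) → H10 D}

theorem estimator_rectangle (i j : Fin N → ℕ) :
    estimator lo hi a₀ a u j (rectangle i) = ⨆ y : paramBox lo hi,
      ‖tensorOp (detailKernels lo hi j) (flux lo hi a₀ a u i) (y : Fin N → ℝ)‖ := by
  unfold estimator
  simp only [surplus_eq_tensorOp, ← flux_eq]

theorem le_level_two_pow {k : ℕ} (hk : 0 < k) : 2 ^ (k - 1) ≤ level k := by
  match k, hk with
  | 1, _ => simp [level]
  | k + 2, _ => simp [level]

/-- The factor in direction `l` of the bound for the estimator on the margin face `n`. -/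
def faceFactor (lo hi τ : Fin N → ℝ) (i : Fin N → ℕ) (n l : Fin N) (k : ℕ) : ℝ :=
  if l = n then
    (|lo l + hi l| + (hi l - lo l)) * (2 / (1 - (ellipseParam (lo l) (hi l) (τ l))⁻¹)) *
      (ellipseParam (lo l) (hi l) (τ l))⁻¹ ^ (level (i l) - 1)
  else 2 * (2 / (1 - (ellipseParam (lo l) (hi l) (τ l))⁻¹)) *
    (ellipseParam (lo l) (hi l) (τ l))⁻¹ ^ level (k - 1)

theorem inv_ellipseParam_mem (h : ∀ n, lo n < hi n) (hτ : ∀ n, 0 < τ n)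
    (n : Fin N) :
    0 < (ellipseParam (lo n) (hi n) (τ n))⁻¹ ∧ (ellipseParam (lo n) (hi n) (τ n))⁻¹ < 1 := by
  have := one_lt_ellipseParam (h n) (hτ n)
  exact ⟨inv_pos.2 (by linarith), inv_lt_one_of_one_lt₀ this⟩

theorem faceFactor_nonneg (h : ∀ n, lo n < hi n) (hτ : ∀ n, 0 < τ n)
    (i : Fin N → ℕ) (n l : Fin N) (k : ℕ) :
    0 ≤ faceFactor lo hi τ i n l k := by
  obtain ⟨h1, h2⟩ := inv_ellipseParam_mem h hτ l
  have h3 : 0 < 1 - (ellipseParam (lo l) (hi l) (τ l))⁻¹ := by linarith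
  have h4 := h l
  have h5 : 0 < hi l - lo l := by linarith
  unfold faceFactor
  split_ifs <;> positivity

theorem norm_surplus_flux_le (h : ∀ n, lo n < hi n) (hτ : ∀ n, 0 < τ n)
    {M : ℝ} (hM : 0 ≤ M)
    (hU : WeaklyHolomorphic lo hi τ M fun y => grad (u y)) {i j : Fin N → ℕ} (hi' : 1 ≤ i)
    {n : Fin N} (hj : j ∈ marginFace i n) {y : Fin N → ℝ} (hy : y ∈ paramBox lo hi) :
    ‖tensorOp (detailKernels lo hi j) (flux lo hi a₀ a u i) y‖ ≤
      ‖a n‖ * ((∏ l, faceFactor lo hi τ i n l (j l)) * M) := by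
  rw [surplus_flux h hj]
  refine (norm_mulField_le _ _).trans (mul_le_mul_of_nonneg_left ?_ (norm_nonneg _))
  refine hU.norm_tensorOp_le hτ hM (fun l => faceFactor_nonneg h hτ i n l (j l)) (fun l => ?_) hy
  obtain ⟨h1, h2⟩ := mem_marginFace.1 hj
  by_cases hl : l = n
  · subst hl
    simp only [detailCoordKernels, Function.update_self, faceFactor, if_true, h1]
    exact boundOn_interp_coord_detail (h l) (hτ l) (hi' l)
  · simp only [detailCoordKernels, Function.update_of_ne hl, faceFactor, if_neg hl]
    exact boundOn_interp_detail (h l) (hτ l) (hi' l) (h2 l hl).2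

/-- The real supremum of an unbounded family would be 0, so the holomorphy bound is needed to make
the estimator dominate pointwise values. -/
theorem norm_surplus_flux_le_estimator (h : ∀ n, lo n < hi n) (hτ : ∀ n, 0 < τ n)
    {M : ℝ} (hM : 0 ≤ M)
    (hU : WeaklyHolomorphic lo hi τ M fun y => grad (u y)) {i j : Fin N → ℕ} (hi' : 1 ≤ i)
    {n : Fin N} (hj : j ∈ marginFace i n) {y : Fin N → ℝ} (hy : y ∈ paramBox lo hi) :
    ‖tensorOp (detailKernels lo hi j) (flux lo hi a₀ a u i) y‖ ≤
      estimator lo hi a₀ a u j (rectangle i) := by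
  rw [estimator_rectangle]
  refine le_ciSup (f := fun y : paramBox lo hi =>
    ‖tensorOp (detailKernels lo hi j) (flux lo hi a₀ a u i) (y : Fin N → ℝ)‖)
    ⟨‖a n‖ * ((∏ l, faceFactor lo hi τ i n l (j l)) * M), ?_⟩ ⟨y, hy⟩
  rintro _ ⟨y', rfl⟩
  exact norm_surplus_flux_le h hτ hM hU hi' hj y'.2

theorem estimator_le (h : ∀ n, lo n < hi n) (hτ : ∀ n, 0 < τ n)
    {M : ℝ} (hM : 0 ≤ M)
    (hU : WeaklyHolomorphic lo hi τ M fun y => grad (u y)) {i j : Fin N → ℕ} (hi' : 1 ≤ i)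
    {n : Fin N} (hj : j ∈ marginFace i n) :
    estimator lo hi a₀ a u j (rectangle i) ≤
      ‖a n‖ * ((∏ l, faceFactor lo hi τ i n l (j l)) * M) := by
  rw [estimator_rectangle]
  refine Real.iSup_le (fun y => norm_surplus_flux_le h hτ hM hU hi' hj y.2) ?_
  exact mul_nonneg (norm_nonneg _)
    (mul_nonneg (Finset.prod_nonneg fun l _ => faceFactor_nonneg h hτ i n l (j l)) hM)

/-- The sums of the factors of the estimator bounds over a margin face. -/
theorem exists_sum_faceFactor_le (h : ∀ n, lo n < hi n) (hτ : ∀ n, 0 < τ n)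
    : ∃ Q : Fin N → ℝ, (∀ l, 0 ≤ Q l) ∧ ∀ i : Fin N → ℕ, 1 ≤ i →
    ∀ n, ∑ j ∈ marginFace i n, ∏ l, faceFactor lo hi τ i n l (j l) ≤
      (∏ l, Q l) * (ellipseParam (lo n) (hi n) (τ n))⁻¹ ^ level (i n) := by
  let r : Fin N → ℝ := fun l => (ellipseParam (lo l) (hi l) (τ l))⁻¹
  have hr := inv_ellipseParam_mem h hτ
  have hr0 : ∀ l, 0 < r l := fun l => (hr l).1
  have hr1 : ∀ l, 0 < 1 - r l := fun l => by have := (hr l).2; simp only [r]; linarith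
  have hw : ∀ l, 0 < hi l - lo l := fun l => by have := h l; linarith
  -- `Q1` bounds the geometric series in a direction other than `n`, `Q2` the single factor in
  -- direction `n`, where `(r l)⁻¹` raises the exponent `level (i l) - 1` to `level (i l)`. Their
  -- sum serves every `n`.
  let Q1 : Fin N → ℝ := fun l => 2 * (2 / (1 - r l)) * (1 / (1 - r l))
  let Q2 : Fin N → ℝ := fun l => (|lo l + hi l| + (hi l - lo l)) * (2 / (1 - r l)) * (r l)⁻¹
  have hQ1 : ∀ l, 0 ≤ Q1 l := fun l => by have := hr1 l; simp only [Q1]; positivity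
  have hQ2 : ∀ l, 0 ≤ Q2 l := fun l => by
    have := hr1 l; have := hr0 l; have := hw l; simp only [Q2]; positivity
  refine ⟨fun l => Q1 l + Q2 l, fun l => add_nonneg (hQ1 l) (hQ2 l), fun i hi' n => ?_⟩
  -- The face is a product set, so the sum of products factorises.
  rw [marginFace, ← Finset.prod_univ_sum]
  have hfac : ∀ l, ∑ k ∈ Function.update (fun l => Finset.Icc 1 (i l)) n {i n + 1} l,
      faceFactor lo hi τ i n l k ≤ (Q1 l + Q2 l) * if l = n then r n ^ level (i n) else 1 := by
    intro l
    by_cases hl : l = n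
    · subst hl
      have hpow : r l ^ (level (i l) - 1) = (r l)⁻¹ * r l ^ level (i l) := by
        obtain ⟨m, hm⟩ := Nat.exists_eq_add_of_lt (level_pos (hi' l))
        rw [hm, zero_add, Nat.add_sub_cancel, pow_succ]
        have := (hr0 l).ne'
        field_simp
      simp only [Function.update_self, Finset.sum_singleton, faceFactor, if_true]
      change _ * r l ^ _ ≤ _
      rw [hpow, ← mul_assoc]
      refine mul_le_mul_of_nonneg_right ?_ (pow_nonneg (hr0 l).le _)
      exact le_add_of_nonneg_left (hQ1 l)
    · simp only [Function.update_of_ne hl, faceFactor, if_neg hl, mul_one]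
      rw [← Finset.mul_sum]
      refine le_trans ?_ (le_add_of_nonneg_right (hQ2 l))
      refine mul_le_mul_of_nonneg_left ?_ (by have := hr1 l; simp only [r] at this; positivity)
      change ∑ k ∈ Finset.Icc 1 (i l), r l ^ level (k - 1) ≤ 1 / (1 - r l)
      calc ∑ k ∈ Finset.Icc 1 (i l), r l ^ level (k - 1)
          ≤ ∑ k ∈ Finset.Icc 1 (i l), r l ^ (k - 1) :=
            Finset.sum_le_sum fun k _ => pow_le_pow_of_le_one (hr0 l).le (by linarith [hr1 l])
              (le_level _)
        _ = ∑ k ∈ Finset.range (i l), r l ^ k := by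
            rw [← Finset.Ico_add_one_right_eq_Icc, Finset.sum_Ico_eq_sum_range]
            simp
        _ ≤ ∑' k, r l ^ k := (summable_geometric_of_lt_one (hr0 l).le
            (by linarith [hr1 l])).sum_le_tsum _ fun k _ => pow_nonneg (hr0 l).le k
        _ = _ := by
            rw [tsum_geometric_of_lt_one (hr0 l).le (by linarith [hr1 l]), one_div]
  refine (Finset.prod_le_prod (fun l _ => Finset.sum_nonneg fun k _ =>
    faceFactor_nonneg h hτ i n l k) fun l _ => hfac l).trans_eq ?_
  rw [Finset.prod_mul_distrib, Finset.prod_ite_eq' Finset.univ n, if_pos (Finset.mem_univ n)]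

theorem rateExponent_nonneg (h : ∀ n, lo n < hi n) (hτ : ∀ n, 0 < τ n)
    : 0 ≤ rateExponent lo hi τ :=
  Real.iInf_nonneg fun n => Real.log_nonneg (one_lt_ellipseParam (h n) (hτ n)).le

theorem inv_ellipseParam_pow_le (h : ∀ n, lo n < hi n) (hτ : ∀ n, 0 < τ n)
    (n : Fin N) (k : ℕ) :
    (ellipseParam (lo n) (hi n) (τ n))⁻¹ ^ k ≤ Real.exp (-(rateExponent lo hi τ * k)) := by
  have hρ := one_lt_ellipseParam (h n) (hτ n)
  have h1 : rateExponent lo hi τ ≤ Real.log (ellipseParam (lo n) (hi n) (τ n)) :=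
    ciInf_le (Set.finite_range _).bddBelow n
  rw [Real.exp_neg, inv_pow]
  refine inv_anti₀ (Real.exp_pos _) ?_
  calc Real.exp (rateExponent lo hi τ * k)
      ≤ Real.exp (Real.log (ellipseParam (lo n) (hi n) (τ n)) * k) := by gcongr
    _ = _ := by
      rw [mul_comm, Real.exp_nat_mul, Real.exp_log (by linarith)]

/-- Exponential decay of the largest workless profits. -/
theorem exists_worklessProfit_le (h : ∀ n, lo n < hi n) (hτ : ∀ n, 0 < τ n)
    (hext : HasBoundedHolomorphicExtension lo hi τ u) :
    ∃ C, 0 ≤ C ∧ ∀ i : Fin N → ℕ, 1 ≤ i → ∀ n,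
      worklessProfit lo hi a₀ a u (i + Pi.single n 1) (rectangle i) ≤
        C * Real.exp (-(rateExponent lo hi τ * level (i n))) := by
  obtain ⟨M, hM, hU⟩ := hext.weaklyHolomorphic
  obtain ⟨Q, hQ0, hQ⟩ := exists_sum_faceFactor_le h hτ
  have hprod : 0 ≤ ∏ l, Q l := Finset.prod_nonneg fun l _ => hQ0 l
  have hsum : 0 ≤ ∑ l, ‖a l‖ := Finset.sum_nonneg fun l _ => norm_nonneg _
  refine ⟨(∑ l, ‖a l‖) * (M * ∏ l, Q l), by positivity, fun i hi' n => ?_⟩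
  rw [worklessProfit, closureInMargin_add_single hi']
  calc _ ≤ ∑ j ∈ marginFace i n, ‖a n‖ * ((∏ l, faceFactor lo hi τ i n l (j l)) * M) :=
        Finset.sum_le_sum fun j hj => estimator_le h hτ hM hU hi' hj
    _ = ‖a n‖ * (M * ∑ j ∈ marginFace i n, ∏ l, faceFactor lo hi τ i n l (j l)) := by
        rw [← Finset.mul_sum, ← Finset.sum_mul, mul_comm M]
    _ ≤ (∑ l, ‖a l‖) * (M * ((∏ l, Q l) *
          Real.exp (-(rateExponent lo hi τ * level (i n))))) := by
        refine mul_le_mul (Finset.single_le_sum (f := fun l => ‖a l‖)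
          (fun l _ => norm_nonneg _) (Finset.mem_univ n)) ?_ ?_ hsum
        · refine mul_le_mul_of_nonneg_left ((hQ i hi' n).trans ?_) hM
          exact mul_le_mul_of_nonneg_left (inv_ellipseParam_pow_le h hτ n _) hprod
        · exact mul_nonneg hM (Finset.sum_nonneg fun j _ => Finset.prod_nonneg fun l _ =>
            faceFactor_nonneg h hτ i n l (j l))
    _ = _ := by ring

/-- Reliability on rectangles, in terms of the largest workless profits. -/
theorem amin_mul_normV_le_sum_worklessProfit (h : ∀ n, lo n < hi n) (hτ : ∀ n, 0 < τ n)
    (hext : HasBoundedHolomorphicExtension lo hi τ u)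
    {amin : ℝ} (ha : ∀ y ∈ paramBox lo hi, ∀ᵐ x ∂(vol D), amin ≤ coeff a₀ a y x)
    {f : L2 D} (hu : IsSolution lo hi a₀ a f u) {i : Fin N → ℕ} (hi' : 1 ≤ i)
    {y : Fin N → ℝ} (hy : y ∈ paramBox lo hi) :
    amin * normV (u y - sparseInterp lo hi (rectangle i) u y) ≤
      ∑ n, worklessProfit lo hi a₀ a u (i + Pi.single n 1) (rectangle i) := by
  obtain ⟨M, hM, hU⟩ := hext.weaklyHolomorphic
  refine (amin_mul_normV_le h ha hu hi' hy).trans ?_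
  rw [margin_rectangle hi', Finset.sum_biUnion fun n _ n' _ hn => disjoint_marginFace hn]
  refine Finset.sum_le_sum fun n _ => ?_
  rw [worklessProfit, closureInMargin_add_single hi']
  exact Finset.sum_le_sum fun j hj => norm_surplus_flux_le_estimator h hτ hM hU hi' hj hy

end Profit

/-! ### Quasi-monotonicity of the error and the convergence rate -/

section Rate

variable {d N : ℕ} {D : Set (Space d)} {lo hi : Fin N → ℝ} {u : (Fin N → ℝ) → H10 D}

/-- With `W = u - S_i u`, the identity `S_j S_i = S_i` gives `u - S_j u = W - S_j W`; the product
bounds the norm of `S_j`. -/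
theorem normV_sub_sparseInterp_le (h : ∀ n, lo n < hi n) {i j : Fin N → ℕ} (hij : i ≤ j) {e : ℝ}
    (he : ∀ y ∈ paramBox lo hi, normV (u y - sparseInterp lo hi (rectangle i) u y) ≤ e)
    {y : Fin N → ℝ} (hy : y ∈ paramBox lo hi) :
    normV (u y - sparseInterp lo hi (rectangle j) u y) ≤ (1 + ∏ n, (8 * j n : ℝ)) * e := by
  set U : (Fin N → ℝ) → L2Vec D := fun y' => grad (u y') with hU
  have hn : ∀ (k : Fin N → ℕ) y', normV (u y' - sparseInterp lo hi (rectangle k) u y') =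
      ‖(U - tensorOp (interpKernels lo hi k) U) y'‖ := by
    intro k y'
    rw [Pi.sub_apply, ← grad_sparseInterp]
    rfl
  set W := U - tensorOp (interpKernels lo hi i) U with hW
  have hWe : ∀ y ∈ paramBox lo hi, ‖W y‖ ≤ e := fun y hy => by
    rw [← hn]
    exact he y hy
  have hS : tensorOp (interpKernels lo hi j) W = tensorOp (interpKernels lo hi j) U -
      tensorOp (interpKernels lo hi i) U := by
    rw [hW, map_sub, ← Module.End.mul_apply, interp_mul_interp h hij]
  have hdecomp : U - tensorOp (interpKernels lo hi j) U =
      W - tensorOp (interpKernels lo hi j) W := by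
    rw [hS, hW]
    abel
  have hstab := norm_tensorOp_le (K := interpKernels lo hi j)
    (fun n => stableOn_interpKernel (h n) (j n)) hWe hy
  rw [hn, hdecomp, add_mul, one_mul]
  exact (norm_sub_le _ _).trans (add_le_add (hWe y hy) hstab)

theorem prod_le_mean_pow (hN : 0 < N) {z : Fin N → ℝ} (hz : ∀ n, 0 ≤ z n) :
    ∏ n, z n ≤ ((∑ n, z n) / N) ^ N := by
  have hN' : (N : ℝ) ≠ 0 := by positivity
  have h1 := Real.geom_mean_le_arith_mean_weighted Finset.univ (fun _ => (N : ℝ)⁻¹) z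
    (fun _ _ => by positivity) (by simp [hN']) fun n _ => hz n
  rw [← Finset.mul_sum, inv_mul_eq_div] at h1
  have h2 := pow_le_pow_left₀ (Finset.prod_nonneg fun n _ => Real.rpow_nonneg (hz n) _) h1 N
  refine le_trans (le_of_eq ?_) h2
  rw [← Finset.prod_pow]
  refine Finset.prod_congr rfl fun n _ => ?_
  rw [← Real.rpow_natCast, ← Real.rpow_mul (hz n), inv_mul_cancel₀ hN', Real.rpow_one]

/-- From `ℓ/N ≤ k` follows `2^(ℓ/N) ≤ 2^k ≤ 2 m(k)`. The factor 2 is what halves `σ`, and the `+ 1`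
costs `e^{σ/2}` in the constant. -/
theorem levelReal_le (hN : 0 < N) {ℓ k : ℕ} (hℓ : 0 < ℓ) (hk : ℓ ≤ N * k) :
    levelReal (1 + (ℓ : ℝ) / N) ≤ 2 * level k + 1 := by
  have hN' : (0 : ℝ) < N := by exact_mod_cast hN
  have hℓ' : (0 : ℝ) < (ℓ : ℝ) / N := by positivity
  have hk0 : 0 < k := Nat.pos_of_ne_zero fun h0 => by subst h0; omega
  rw [levelReal, if_neg (by linarith), if_neg (by linarith), add_sub_cancel_left]
  have h1 : (ℓ : ℝ) / N ≤ k := by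
    rw [div_le_iff₀ hN', mul_comm]
    exact_mod_cast hk
  have h2 : (2 : ℝ) ^ ((ℓ : ℝ) / N) ≤ 2 ^ k := by
    rw [← Real.rpow_natCast]
    exact Real.rpow_le_rpow_of_exponent_le one_le_two h1
  have h3 : (2 : ℝ) ^ k ≤ 2 * level k := by
    obtain ⟨m, rfl⟩ := Nat.exists_eq_add_of_lt hk0
    have : ((2 ^ (0 + m + 1 - 1) : ℕ) : ℝ) ≤ level (0 + m + 1) := by
      exact_mod_cast le_level_two_pow hk0
    rw [Nat.add_sub_cancel] at this
    push_cast at this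
    rw [pow_succ]
    linarith
  linarith

end Rate

end SparseCollocation

end

open SparseCollocation

theorem mainTheorem4 {d N : ℕ} (hd : 2 ≤ d) (hN : 0 < N)
    (D : Set (SparseCollocation.Space d)) (hD : IsOpen D) (hDb : Bornology.IsBounded D)
    (lo hi : Fin N → ℝ) (hΓ : ∀ n, lo n < hi n)
    (a₀ : SparseCollocation.LInf D) (a : Fin N → SparseCollocation.LInf D)
    (amin amax : ℝ) (hamin : 0 < amin)
    (ha : ∀ y ∈ SparseCollocation.paramBox lo hi, ∀ᵐ x ∂(MeasureTheory.volume.restrict D),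
      amin ≤ SparseCollocation.coeff a₀ a y x ∧ SparseCollocation.coeff a₀ a y x ≤ amax)
    (f : SparseCollocation.L2 D)
    (u : (Fin N → ℝ) → SparseCollocation.H10 D)
    (hu : SparseCollocation.IsSolution lo hi a₀ a f u)
    (τ : Fin N → ℝ) (hτ : ∀ n, 0 < τ n)
    (hext : SparseCollocation.HasBoundedHolomorphicExtension lo hi τ u) :
    (∀ (I : ℕ → Finset (Fin N → ℕ)) (i : ℕ → Fin N → ℕ),
      SparseCollocation.IsWorklessRun lo hi a₀ a u I i →
        ∀ ℓ : ℕ, I (ℓ + 1) = SparseCollocation.rectangle (i ℓ)) ∧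
    ∃ C : ℝ, 0 < C ∧
      ∀ (I : ℕ → Finset (Fin N → ℕ)) (i : ℕ → Fin N → ℕ),
        SparseCollocation.IsWorklessRun lo hi a₀ a u I i →
          ∀ ℓ : ℕ, 0 < ℓ → ∀ y ∈ SparseCollocation.paramBox lo hi,
            SparseCollocation.normV (u y - SparseCollocation.sparseInterp lo hi (I ℓ) u y) ≤
              C * ((1 + (1 + ((ℓ : ℝ) - 1) / (N : ℝ)) ^ N) * (N : ℝ) * (ℓ : ℝ) ^ 2 *
                Real.exp (-(SparseCollocation.rateExponent lo hi τ / 2) *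
                  SparseCollocation.levelReal (1 + (ℓ : ℝ) / (N : ℝ)))) := by
  refine ⟨fun I i hrun ℓ => (hrun.rectangle ℓ).2, ?_⟩
  obtain ⟨C, hC0, hC⟩ := exists_worklessProfit_le (a₀ := a₀) (a := a) hΓ hτ hext
  have hσ := rateExponent_nonneg hΓ hτ
  set σ := rateExponent lo hi τ with hσdef
  have hN' : (0 : ℝ) < N := by exact_mod_cast hN
  -- `8 ^ N` stems from the Lebesgue constants and `exp (σ / 2)` from `levelReal_le`; the `+ 1`
  -- keeps the constant positive when `C = 0`.
  refine ⟨amin⁻¹ * C * 8 ^ N * Real.exp (σ / 2) + 1, by positivity, ?_⟩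
  intro I i hrun ℓ hℓ y hy
  obtain ⟨m, rfl⟩ := Nat.exists_eq_add_of_lt hℓ
  simp only [zero_add] at hℓ ⊢
  -- a direction that has been enriched often enough
  obtain ⟨n, hn⟩ : ∃ n, N + (m + 1) ≤ N * i (m + 1) n := by
    by_contra! hcon
    have h1 : ∑ n, N * i (m + 1) n < ∑ _n : Fin N, (N + (m + 1)) :=
      Finset.sum_lt_sum_of_nonempty ⟨⟨0, hN⟩, Finset.mem_univ _⟩ fun n _ => hcon n
    rw [← Finset.mul_sum, hrun.sum_index] at h1
    simp at h1
  have hn1 : 1 < i (m + 1) n := by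
    by_contra hcon
    have : N * i (m + 1) n ≤ N * 1 := Nat.mul_le_mul_left N (not_lt.1 hcon)
    omega
  obtain ⟨p, hp, hstep, hpn⟩ := hrun.exists_last_step hn1
  obtain ⟨hp1, hpI⟩ := hrun.rectangle p
  -- the error when that direction was enriched for the last time
  have herr : ∀ y ∈ paramBox lo hi, normV (u y - sparseInterp lo hi (rectangle (i p)) u y) ≤
      amin⁻¹ * (N * (C * Real.exp (-(σ * level (i p n))))) := by
    intro y hy
    rw [inv_mul_eq_div, le_div_iff₀ hamin, mul_comm]
    refine (amin_mul_normV_le_sum_worklessProfit hΓ hτ hext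
      (fun y hy => (ha y hy).mono fun x hx => hx.1) hu hp1 hy).trans ?_
    -- At step `p + 1` the corner of direction `n` was selected, so its profit dominates all corner
    -- profits, and the decay bound is applied to it alone.
    have hmax : ∀ n', worklessProfit lo hi a₀ a u (i p + Pi.single n' 1) (rectangle (i p)) ≤
        C * Real.exp (-(σ * level (i p n))) := by
      intro n'
      have := hrun.profit_max (p + 1) (Nat.succ_pos p) (i p + Pi.single n' 1)
        (by rw [hpI]; exact (mem_margin_rectangle hp1).2 ⟨n', add_single_mem_marginFace hp1 n'⟩)
      rw [hpI, hstep] at this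
      exact this.trans (hC (i p) hp1 n)
    exact (Finset.sum_le_sum fun n' _ => hmax n').trans_eq (by simp)
  have hmain := normV_sub_sparseInterp_le hΓ (hrun.monotone (Nat.lt_succ_iff.1 hp)) herr hy
  rw [(hrun.rectangle m).2]
  refine hmain.trans ?_
  have hprod : ∏ n, (8 * i m n : ℝ) ≤ 8 ^ N * (1 + ((m + 1 : ℕ) - 1 : ℝ) / N) ^ N := by
    rw [Finset.prod_mul_distrib, Finset.prod_const, Finset.card_univ, Fintype.card_fin]
    refine mul_le_mul_of_nonneg_left ?_ (by positivity)
    refine (prod_le_mean_pow hN fun n => Nat.cast_nonneg (i m n)).trans_eq ?_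
    have hsum : ∑ n, (i m n : ℝ) = N + m := by exact_mod_cast hrun.sum_index m
    rw [hsum]
    congr 1
    push_cast
    field_simp
    ring
  have hexp : Real.exp (-(σ * level (i p n))) ≤ Real.exp (σ / 2) *
      Real.exp (-(σ / 2) * levelReal (1 + ((m + 1 : ℕ) : ℝ) / N)) := by
    rw [← Real.exp_add]
    refine Real.exp_le_exp.2 ?_
    -- Here `i p n` is one less than `i (m + 1) n`, which uses up exactly the summand `N` of the
    -- pigeonhole bound.
    have hle : m + 1 ≤ N * i p n := by
      rw [← hpn, mul_add, mul_one] at hn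
      omega
    have := mul_le_mul_of_nonneg_left (levelReal_le hN hℓ hle) hσ
    linarith
  set X := (1 + ((m + 1 : ℕ) - 1 : ℝ) / N) ^ N with hX
  set L := Real.exp (-(σ / 2) * levelReal (1 + ((m + 1 : ℕ) : ℝ) / N)) with hL
  have hX0 : 0 ≤ X := by
    rw [hX]
    push_cast
    rw [add_sub_cancel_right]
    positivity
  have h8 : (1 : ℝ) ≤ 8 ^ N := one_le_pow₀ (by norm_num)
  have hL0 : 0 ≤ L := (Real.exp_pos _).le
  -- The factor `ℓ²` enters only through `ℓ² ≥ 1`.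
  have hm1 : (1 : ℝ) ≤ ((m + 1 : ℕ) : ℝ) ^ 2 := one_le_pow₀ (by exact_mod_cast hℓ)
  have hfac : 1 + ∏ n, (8 * i m n : ℝ) ≤ 8 ^ N * (1 + X) := by linarith
  calc (1 + ∏ n, (8 * i m n : ℝ)) * (amin⁻¹ * (N * (C * Real.exp (-(σ * level (i p n))))))
      ≤ (8 ^ N * (1 + X)) * (amin⁻¹ * (N * (C * (Real.exp (σ / 2) * L)))) := by gcongr
    _ = (amin⁻¹ * C * 8 ^ N * Real.exp (σ / 2)) * ((1 + X) * N * 1 * L) := by ring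
    _ ≤ (amin⁻¹ * C * 8 ^ N * Real.exp (σ / 2) + 1) *
        ((1 + X) * N * ((m + 1 : ℕ) : ℝ) ^ 2 * L) := by
      gcongr
      exact le_add_of_nonneg_right zero_le_one
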